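/- Let $n$ be a natural number, let $K\subset\mathbb{R}^n$ be a closed convex set and let $\mu_0\in K$. For $h\in\mathbb{R}^n$ and $\sigma>0$ put $y=\mu_0+\sigma h$, let $\Pi_K$ be the Euclidean projection onto $K$, and let $\hat\mu(\sigma)=\Pi_K(y)=\operatorname{argmin}_{\mu\in K}\|y-\mu\|^2$. Define $$\mathrm{err}(\sigma)=\|\hat\mu(\sigma)-\mu_0\|^2,\qquad \mathrm{lrt}(\sigma)=\|y-\mu_0\|^2-\|y-\hat\mu(\sigma)\|^2 ,$$ and let $\operatorname{div}\hat\mu(\sigma)=\sum_{i=1}^n \partial (\Pi_K)_i(y)/\partial y_i$ be the divergence of $\Pi_K$ at $y$, which is defined for almost every $y$. Probabilities, expectations and variances are taken with $h\sim N(0,I_n)$. All expectations below are finite (the exponential moment under its stated condition on $\lambda$), and for every $\sigma>0$ the following hold. 1. $\mathbb{E}\,\mathrm{lrt}(\sigma)\le 2\sigma^2\,\mathbb{E}\operatorname{div}\hat\mu(\sigma)\le 2\sigma^2 n$. 2. For every $h\in\mathbb{R}^n$, the integral below converges and $$\mathrm{err}(\sigma)\le \mathrm{lrt}(\sigma)\le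 \mathrm{err}(\sigma)+2\sigma\int_0^\sigma\Big(\frac{\mathrm{err}(\tau)}{\tau^2}-\frac{\mathrm{err}(\sigma)}{\sigma^2}\Big)\,d\tau .$$ If moreover $K$ is a closed convex cone, then for every $h\in\mathbb{R}^n$ and every (possibly random, that is, depending on $h$) $\nu\in\mathbb{R}^n$ such that $K+\nu\subset K$ and $\hat\mu(\sigma)-\nu\in K$, $$\mathrm{err}(\sigma)\le \mathrm{lrt}(\sigma)\le \mathrm{err}(\sigma)+2\langle \hat\mu(\sigma)-\mu_0-\sigma h,\ \mu_0-\nu\rangle ;$$ the vector $\nu=\hat\mu(\sigma)$ satisfies these conditions, and for it the right-hand inequality is an equality. 3. $\operatorname{Var}(\mathrm{lrt}(\sigma))\le 4\sigma^2\,\mathbb{E}\,\mathrm{err}(\sigma)$. 4. For every $\lambda\in\mathbb{R}$ with $\lambda^2<\mathbb{E}\,\mathrm{err}(\sigma)/(8\sigma^2)$, $$\mathbb{E}\exp\Big[\lambda\cdot\frac{\mathrm{lrt}(\sigma)-\mathbb{E}\,\mathrm{lrt}(\sigma)}{\sigma\,(\mathbb{E}\,\mathrm{err}(\sigma))^{1/2}}\Big]\le\exp\Big(\frac{4\lambda^2}{1-8\big(\sigma^2/\mathbb{E}\,\mathrm{err}(\sigma)\big)\lambda^2}\Big).$$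 Moreover, there is an absolute constant $L>0$ (independent of $n,K,\mu_0,\sigma,t$) such that for all $t\ge 0$ $$\mathbb{P}\Big(L^{-1}\big|\mathrm{lrt}(\sigma)-\mathbb{E}\,\mathrm{lrt}(\sigma)\big|\ge\sqrt{\sigma^2\cdot\mathbb{E}\,\mathrm{err}(\sigma)\cdot t}+\sigma^2 t\Big)\le L\,e^{-t/L}.$$ -/

import Mathlib

open MeasureTheory ProbabilityTheory

namespace SeqModel

/-- `p` is a minimizer of `μ ↦ ‖y - μ‖²` over `μ ∈ K`, for the Euclidean norm. -/
def IsLeastSquares {n : ℕ} (K : Set (EuclideanSpace ℝ (Fin n)))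
    (y p : EuclideanSpace ℝ (Fin n)) : Prop :=
  p ∈ K ∧ ∀ q ∈ K, ‖y - p‖ ^ 2 ≤ ‖y - q‖ ^ 2

/-- Over a nonempty closed convex set the least squares problem has exactly one solution. -/
theorem existsUnique_isLeastSquares {n : ℕ} {K : Set (EuclideanSpace ℝ (Fin n))}
    (hc : IsClosed K) (hK : Convex ℝ K) (hne : K.Nonempty) (y : EuclideanSpace ℝ (Fin n)) :
    ∃! p, IsLeastSquares K y p := by
  obtain ⟨p, hp, hmin⟩ := exists_norm_eq_iInf_of_complete_convex hne hc.isComplete hK y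
  have hbdd : BddBelow (Set.range fun w : K => ‖y - w‖) :=
    ⟨0, by rintro _ ⟨w, rfl⟩; exact norm_nonneg _⟩
  have hle : ∀ q ∈ K, ‖y - p‖ ≤ ‖y - q‖ := fun q hq => by
    rw [hmin]; exact ciInf_le hbdd ⟨q, hq⟩
  refine ⟨p, ⟨hp, fun q hq => pow_le_pow_left₀ (norm_nonneg _) (hle q hq) 2⟩, ?_⟩
  rintro q ⟨hq, hqmin⟩
  have h1 := (norm_eq_iInf_iff_real_inner_le_zero hK hp).1 hmin q hq
  have h2 := hqmin p hp
  have h3 : ‖y - q‖ ^ 2 = ‖y - p‖ ^ 2 - 2 * inner ℝ (y - p) (q - p) + ‖q - p‖ ^ 2 := by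
    rw [← norm_sub_sq_real]; congr 2; abel
  have h4 : ‖q - p‖ ^ 2 ≤ 0 := by linarith
  have h5 : ‖q - p‖ = 0 := by
    have := norm_nonneg (q - p)
    nlinarith
  exact sub_eq_zero.1 (norm_eq_zero.1 h5)

open Classical in
/-- The projection `y ↦ argmin_{μ ∈ K} ‖y - μ‖²` onto `K`; it is meant for nonempty closed convex
`K`, where the minimizer exists and is unique. -/
noncomputable def proj {n : ℕ} (K : Set (EuclideanSpace ℝ (Fin n)))
    (y : EuclideanSpace ℝ (Fin n)) : EuclideanSpace ℝ (Fin n) :=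
  if h : ∃ p, IsLeastSquares K y p then h.choose else 0

theorem isLeastSquares_iff_eq_proj {n : ℕ} {K : Set (EuclideanSpace ℝ (Fin n))}
    (hc : IsClosed K) (hK : Convex ℝ K) (hne : K.Nonempty) (y p : EuclideanSpace ℝ (Fin n)) :
    IsLeastSquares K y p ↔ p = proj K y := by
  have hu := existsUnique_isLeastSquares hc hK hne y
  have hs : IsLeastSquares K y (proj K y) := by
    rw [proj, dif_pos hu.exists]; exact hu.exists.choose_spec
  exact ⟨fun h => hu.unique h hs, fun h => h ▸ hs⟩

/-- The observation `y = μ₀ + σ h` of the Gaussian sequence model, with noise `h`. -/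
noncomputable def obs {n : ℕ} (μ₀ : EuclideanSpace ℝ (Fin n)) (σ : ℝ)
    (h : EuclideanSpace ℝ (Fin n)) : EuclideanSpace ℝ (Fin n) :=
  μ₀ + σ • h

/-- The convex constrained least squares estimator `μ̂_K(σ)` computed from `y = μ₀ + σ h`. -/
noncomputable def lse {n : ℕ} (K : Set (EuclideanSpace ℝ (Fin n)))
    (μ₀ : EuclideanSpace ℝ (Fin n)) (σ : ℝ) (h : EuclideanSpace ℝ (Fin n)) :
    EuclideanSpace ℝ (Fin n) :=
  proj K (obs μ₀ σ h)

/-- The squared error `‖μ̂_K(σ) - μ₀‖²`. -/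
noncomputable def err {n : ℕ} (K : Set (EuclideanSpace ℝ (Fin n)))
    (μ₀ : EuclideanSpace ℝ (Fin n)) (σ : ℝ) (h : EuclideanSpace ℝ (Fin n)) : ℝ :=
  ‖lse K μ₀ σ h - μ₀‖ ^ 2

/-- The (scaled) log likelihood ratio statistic `‖y - μ₀‖² - ‖y - μ̂_K(σ)‖²`. -/
noncomputable def lrt {n : ℕ} (K : Set (EuclideanSpace ℝ (Fin n)))
    (μ₀ : EuclideanSpace ℝ (Fin n)) (σ : ℝ) (h : EuclideanSpace ℝ (Fin n)) : ℝ :=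
  ‖obs μ₀ σ h - μ₀‖ ^ 2 - ‖obs μ₀ σ h - lse K μ₀ σ h‖ ^ 2

/-- The divergence `∑ᵢ ∂fᵢ/∂zᵢ` of a vector field `f` at `z`. -/
noncomputable def divergence {n : ℕ}
    (f : EuclideanSpace ℝ (Fin n) → EuclideanSpace ℝ (Fin n)) (z : EuclideanSpace ℝ (Fin n)) : ℝ :=
  ∑ i : Fin n, lineDeriv ℝ (fun w => f w i) z (EuclideanSpace.single i 1)

/-- `div μ̂_K(σ)`: the divergence of the estimator, as a function of the observation, evaluated at
`y = μ₀ + σ h`. -/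
noncomputable def divLse {n : ℕ} (K : Set (EuclideanSpace ℝ (Fin n)))
    (μ₀ : EuclideanSpace ℝ (Fin n)) (σ : ℝ) (h : EuclideanSpace ℝ (Fin n)) : ℝ :=
  divergence (proj K) (obs μ₀ σ h)

/-- The law `N(0, Iₙ)` of the noise vector `h`. -/
noncomputable abbrev gauss (n : ℕ) : Measure (EuclideanSpace ℝ (Fin n)) :=
  stdGaussian (EuclideanSpace ℝ (Fin n))

/-- `E err(σ)`. -/
noncomputable def meanErr {n : ℕ} (K : Set (EuclideanSpace ℝ (Fin n)))
    (μ₀ : EuclideanSpace ℝ (Fin n)) (σ : ℝ) : ℝ :=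
  ∫ h, err K μ₀ σ h ∂gauss n

/-- `E lrt(σ)`. -/
noncomputable def meanLrt {n : ℕ} (K : Set (EuclideanSpace ℝ (Fin n)))
    (μ₀ : EuclideanSpace ℝ (Fin n)) (σ : ℝ) : ℝ :=
  ∫ h, lrt K μ₀ σ h ∂gauss n

end SeqModel

/-!
Put `g(x) = ‖x‖² - ‖μ₀ + x - Π_K (μ₀ + x)‖²` and `d(x) = Π_K (μ₀ + x) - μ₀`, so that
`lrt(σ) = g(σ h)` and `err(σ) = ‖d(σ h)‖²`. By the variational inequality for the projection, `g` is
of class `C¹` with gradient `2 d`, and `d` is `1`-Lipschitz. Everything follows from this.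

* Gaussian integration by parts for `⟪h, d(σ h)⟫` relates `E lrt` and `E err` to `E div`.
* Along a ray, `lrt(τ) / τ` has derivative `err(τ) / τ²`, and `err(τ) / τ²` is nonincreasing.
* The gradient of `lrt` satisfies `‖∇ lrt‖² = 4 σ² err`. Interpolating between independent Gaussian
  vectors by rotations (Mehler's formula) and integrating by parts bounds the moment generating
  function of `lrt - E lrt` by an exponential moment of `err`. Since `d` is `1`-Lipschitz, also
  `‖∇ err‖² ≤ 4 σ² err`, so that the same interpolation bounds this moment in terms of `E err`. The
  variance, exponential moment and tail bounds are consequences of this single sub-gamma bound.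
-/

open Filter Topology Set
open scoped Gradient NNReal RealInnerProductSpace

namespace GaussianConcentration

section SubGamma

variable {Ω : Type*} [MeasurableSpace Ω] {μ : Measure Ω} {X : Ω → ℝ} {v c t : ℝ}

theorem integral_le_of_tendsto_of_nonneg {F : ℕ → Ω → ℝ} {f : Ω → ℝ} {b : ℕ → ℝ} {B : ℝ}
    (hF_nonneg : ∀ k x, 0 ≤ F k x) (hF : ∀ k, Integrable (F k) μ)
    (hlim : ∀ x, Tendsto (fun k ↦ F k x) atTop (𝓝 (f x)))
    (hb : ∀ k, ∫ x, F k x ∂μ ≤ b k) (hB : Tendsto b atTop (𝓝 B)) :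
    Integrable f μ ∧ ∫ x, f x ∂μ ≤ B := by
  have hf_nonneg x : 0 ≤ f x := ge_of_tendsto' (hlim x) fun k ↦ hF_nonneg k x
  have hB_nonneg : 0 ≤ B := ge_of_tendsto' hB fun k ↦ (integral_nonneg (hF_nonneg k)).trans (hb k)
  have hf_meas : AEStronglyMeasurable f μ :=
    aestronglyMeasurable_of_tendsto_ae atTop (fun k ↦ (hF k).aestronglyMeasurable) (.of_forall hlim)
  have fatou : ∫⁻ x, ENNReal.ofReal (f x) ∂μ ≤ ENNReal.ofReal B :=
    calc ∫⁻ x, ENNReal.ofReal (f x) ∂μ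
        = ∫⁻ x, liminf (fun k ↦ ENNReal.ofReal (F k x)) atTop ∂μ :=
          lintegral_congr fun x ↦ ((ENNReal.tendsto_ofReal (hlim x)).liminf_eq).symm
      _ ≤ liminf (fun k ↦ ∫⁻ x, ENNReal.ofReal (F k x) ∂μ) atTop :=
          lintegral_liminf_le' fun k ↦ (hF k).aemeasurable.ennreal_ofReal
      _ ≤ liminf (fun k ↦ ENNReal.ofReal (b k)) atTop := by
          refine liminf_le_liminf (.of_forall fun k ↦ ?_)
          rw [← ofReal_integral_eq_lintegral_ofReal (hF k) (.of_forall (hF_nonneg k))]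
          exact ENNReal.ofReal_le_ofReal (hb k)
      _ = ENNReal.ofReal B := (ENNReal.tendsto_ofReal hB).liminf_eq
  refine ⟨⟨hf_meas, ?_⟩, ?_⟩
  · rw [hasFiniteIntegral_iff_ofReal (.of_forall hf_nonneg)]
    exact fatou.trans_lt ENNReal.ofReal_lt_top
  · rw [integral_eq_lintegral_of_nonneg_ae (.of_forall hf_nonneg) hf_meas]
    exact ENNReal.toReal_le_of_le_ofReal hB_nonneg fatou

theorem two_add_sq_le_exp_add_exp_neg (x : ℝ) : 2 + x ^ 2 ≤ Real.exp x + Real.exp (-x) := by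
  have sq_le_sinh_sq : (x / 2) ^ 2 ≤ Real.sinh (x / 2) ^ 2 :=
    sq_le_sq.2 (by rw [Real.abs_sinh]; exact Real.self_le_sinh_iff.2 (abs_nonneg _))
  have cosh_eq : Real.cosh x = 1 + 2 * Real.sinh (x / 2) ^ 2 := by
    have := Real.cosh_two_mul (x / 2)
    rw [mul_div_cancel₀ x two_ne_zero] at this
    linarith [Real.cosh_sq (x / 2)]
  linarith [Real.cosh_eq x]

/-- `X` is sub-gamma on both tails with variance factor `v` and scale parameter `c`, in the sense
of Boucheron, Lugosi and Massart. -/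
structure HasSubGammaMGF (X : Ω → ℝ) (v c : ℝ) (μ : Measure Ω) : Prop where
  integrable_exp_mul : ∀ k, c * |k| < 1 → Integrable (fun ω ↦ Real.exp (k * X ω)) μ
  mgf_le : ∀ k, c * |k| < 1 → mgf X μ k ≤ Real.exp (v * k ^ 2 / (2 * (1 - c * |k|)))

namespace HasSubGammaMGF

theorem neg (hX : HasSubGammaMGF X v c μ) : HasSubGammaMGF (-X) v c μ where
  integrable_exp_mul k hk := by
    simpa only [Pi.neg_apply, mul_neg, neg_mul] using hX.integrable_exp_mul (-k) (by rwa [abs_neg])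
  mgf_le k hk := by
    simpa only [mgf_neg, abs_neg, neg_sq] using hX.mgf_le (-k) (by rwa [abs_neg])

theorem const_mul (hX : HasSubGammaMGF X v c μ) (a : ℝ) :
    HasSubGammaMGF (fun ω ↦ a * X ω) (a ^ 2 * v) (|a| * c) μ where
  integrable_exp_mul k hk := by
    have := hX.integrable_exp_mul (k * a) (by rwa [abs_mul, mul_comm |k|, ← mul_assoc, mul_comm c])
    simpa only [mul_assoc] using this
  mgf_le k hk := by
    rw [mgf_const_mul]
    refine (hX.mgf_le (a * k) (by rwa [abs_mul, ← mul_assoc, mul_comm c])).trans_eq ?_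
    rw [abs_mul]
    ring_nf

theorem of_tendsto {Y : ℕ → Ω → ℝ} {w : ℕ → ℝ} (hY : ∀ j, HasSubGammaMGF (Y j) (w j) c μ)
    (hlim : ∀ ω, Tendsto (fun j ↦ Y j ω) atTop (𝓝 (X ω))) (hw : Tendsto w atTop (𝓝 v)) :
    HasSubGammaMGF X v c μ := by
  have key k (hk : c * |k| < 1) := integral_le_of_tendsto_of_nonneg
    (fun _ _ ↦ (Real.exp_pos _).le) (fun j ↦ (hY j).integrable_exp_mul k hk)
    (fun ω ↦ ((hlim ω).const_mul k).rexp) (fun j ↦ (hY j).mgf_le k hk)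
    ((hw.mul_const (k ^ 2)).div_const (2 * (1 - c * |k|))).rexp
  exact ⟨fun k hk ↦ (key k hk).1, fun k hk ↦ (key k hk).2⟩

theorem zero_mem_interior_integrableExpSet (hX : HasSubGammaMGF X v c μ) :
    0 ∈ interior (integrableExpSet X μ) := by
  rw [mem_interior_iff_mem_nhds]
  have : Tendsto (fun k : ℝ ↦ c * |k|) (𝓝 0) (𝓝 0) :=
    Continuous.tendsto' (by fun_prop) 0 0 (by simp)
  filter_upwards [this.eventually_lt_const one_pos] with k hk using hX.integrable_exp_mul k hk

theorem memLp_two (hX : HasSubGammaMGF X v c μ) : MemLp X 2 μ :=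
  memLp_of_mem_interior_integrableExpSet hX.zero_mem_interior_integrableExpSet 2

theorem integral_sq_le_of_pos [IsProbabilityMeasure μ] (hX : HasSubGammaMGF X v c μ) {k : ℝ}
    (hk : 0 < k) (hck : c * k < 1) :
    ∫ ω, X ω ^ 2 ∂μ ≤ v / (1 - c * k) * Real.exp (v * k ^ 2 / (2 * (1 - c * k))) := by
  have hck' : c * |k| < 1 := by rwa [abs_of_pos hk]
  set s := v * k ^ 2 / (2 * (1 - c * k)) with hs
  have sum_le : 2 + k ^ 2 * ∫ ω, X ω ^ 2 ∂μ ≤ 2 * Real.exp s :=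
    calc 2 + k ^ 2 * ∫ ω, X ω ^ 2 ∂μ = ∫ ω, (2 + k ^ 2 * X ω ^ 2) ∂μ := by
          rw [integral_add (integrable_const _) (hX.memLp_two.integrable_sq.const_mul _),
            integral_const_mul, integral_const, probReal_univ, one_smul]
      _ ≤ ∫ ω, (Real.exp (k * X ω) + Real.exp (k * (-X) ω)) ∂μ := by
          refine integral_mono ((integrable_const _).add (hX.memLp_two.integrable_sq.const_mul _))
            ((hX.integrable_exp_mul k hck').add (hX.neg.integrable_exp_mul k hck')) fun ω ↦ ?_
          simpa only [mul_pow, Pi.neg_apply, mul_neg] using two_add_sq_le_exp_add_exp_neg (k * X ω)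
      _ = mgf X μ k + mgf (-X) μ k :=
          integral_add (hX.integrable_exp_mul k hck') (hX.neg.integrable_exp_mul k hck')
      _ ≤ 2 * Real.exp s := by
          have h₁ := hX.mgf_le k hck'
          have h₂ := hX.neg.mgf_le k hck'
          rw [abs_of_pos hk] at h₁ h₂
          linarith
  have exp_sub_one_le : Real.exp s - 1 ≤ s * Real.exp s := by
    have : Real.exp (-s) * Real.exp s = 1 := by rw [← Real.exp_add, neg_add_cancel, Real.exp_zero]
    nlinarith [Real.one_sub_le_exp_neg s, Real.exp_pos s]
  have hs' : 2 * s = k ^ 2 * (v / (1 - c * k)) := by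
    rw [hs]; field_simp
  refine le_of_mul_le_mul_left ?_ (pow_pos hk 2)
  calc k ^ 2 * ∫ ω, X ω ^ 2 ∂μ ≤ 2 * s * Real.exp s := by linarith
    _ = k ^ 2 * (v / (1 - c * k) * Real.exp s) := by rw [hs', mul_assoc]

theorem integral_sq_le [IsProbabilityMeasure μ] (hX : HasSubGammaMGF X v c μ) :
    ∫ ω, X ω ^ 2 ∂μ ≤ v := by
  have hlim : Tendsto (fun k ↦ v / (1 - c * k) * Real.exp (v * k ^ 2 / (2 * (1 - c * k))))
      (𝓝[>] 0) (𝓝 v) := by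
    have : ContinuousAt (fun k ↦ v / (1 - c * k) * Real.exp (v * k ^ 2 / (2 * (1 - c * k)))) 0 := by
      fun_prop (disch := simp)
    simpa using this.tendsto.mono_left nhdsWithin_le_nhds
  have hsmall : ∀ᶠ k in 𝓝[>] (0 : ℝ), c * k < 1 :=
    (((continuous_const_mul c).tendsto' 0 0 (mul_zero c)).eventually_lt_const one_pos).filter_mono
      nhdsWithin_le_nhds
  refine ge_of_tendsto hlim ?_
  filter_upwards [self_mem_nhdsWithin, hsmall] with k hk hck using hX.integral_sq_le_of_pos hk hck

theorem variance_le [IsProbabilityMeasure μ] (hX : HasSubGammaMGF X v c μ) : variance X μ ≤ v :=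
  (variance_le_expectation_sq hX.memLp_two.1).trans hX.integral_sq_le

theorem measureReal_ge_le_exp [IsFiniteMeasure μ] (hX : HasSubGammaMGF X v c μ) (hc : 0 ≤ c)
    {r : ℝ} (hr : 0 ≤ r) (ε : ℝ) :
    μ.real {ω | ε ≤ X ω} ≤ Real.exp ((v * r ^ 2 / 2 - r * ε) / (1 + c * r)) := by
  have hk : 0 ≤ r / (1 + c * r) := by positivity
  have one_sub : 1 - c * (r / (1 + c * r)) = (1 + c * r)⁻¹ := by field_simp; ring
  have hck : c * |r / (1 + c * r)| < 1 := by
    rw [abs_of_nonneg hk, ← sub_pos, one_sub]; positivity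
  calc μ.real {ω | ε ≤ X ω}
      ≤ Real.exp (-(r / (1 + c * r)) * ε) * mgf X μ (r / (1 + c * r)) :=
        measure_ge_le_exp_mul_mgf ε hk (hX.integrable_exp_mul _ hck)
    _ ≤ Real.exp (-(r / (1 + c * r)) * ε) * Real.exp
          (v * (r / (1 + c * r)) ^ 2 / (2 * (1 - c * |r / (1 + c * r)|))) := by
        gcongr; exact hX.mgf_le _ hck
    _ = Real.exp ((v * r ^ 2 / 2 - r * ε) / (1 + c * r)) := by
        rw [← Real.exp_add, abs_of_nonneg hk, one_sub]; congr 1; field_simp; ring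

theorem measureReal_ge_le [IsFiniteMeasure μ] (hX : HasSubGammaMGF X v c μ) (hv : 0 ≤ v)
    (hc : 0 < c) (ht : 0 ≤ t) : μ.real {ω | √(2 * v * t) + c * t ≤ X ω} ≤ Real.exp (-t) := by
  rcases hv.eq_or_lt' with rfl | hv
  · have hlim : Tendsto (fun r : ℝ ↦ Real.exp (-t + t / (1 + c * r))) atTop
        (𝓝 (Real.exp (-t + 0))) :=
      ((tendsto_const_nhds.div_atTop (tendsto_atTop_add_const_left _ _
        (tendsto_id.const_mul_atTop hc))).const_add _).rexp
    rw [add_zero] at hlim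
    refine ge_of_tendsto hlim ?_
    filter_upwards [eventually_ge_atTop 0] with r hr
    have hcr : 0 < 1 + c * r := by positivity
    refine (hX.measureReal_ge_le_exp hc.le hr _).trans_eq ?_
    rw [mul_zero, zero_mul, zero_mul, Real.sqrt_zero]
    congr 1
    rw [div_eq_iff hcr.ne', add_mul, div_mul_cancel₀ _ hcr.ne']
    ring
  · set r := √(2 * t / v) with hr
    have hr_sq : v * r ^ 2 = 2 * t := by rw [hr, Real.sq_sqrt (by positivity)]; field_simp
    have sqrt_eq : √(2 * v * t) = v * r := by
      rw [Real.sqrt_eq_iff_mul_self_eq (by positivity) (by positivity)]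
      linear_combination (-v) * hr_sq
    have hcr : 0 < 1 + c * r := by positivity
    refine (hX.measureReal_ge_le_exp hc.le (Real.sqrt_nonneg (2 * t / v)) _).trans_eq ?_
    rw [← hr, sqrt_eq, hr_sq]
    congr 1
    rw [div_eq_iff hcr.ne']
    linear_combination -hr_sq

theorem measureReal_abs_ge_le [IsFiniteMeasure μ] (hX : HasSubGammaMGF X v c μ) (hv : 0 ≤ v)
    (hc : 0 < c) (ht : 0 ≤ t) :
    μ.real {ω | √(2 * v * t) + c * t ≤ |X ω|} ≤ 2 * Real.exp (-t) :=
  calc μ.real {ω | √(2 * v * t) + c * t ≤ |X ω|}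
      = μ.real ({ω | √(2 * v * t) + c * t ≤ X ω} ∪ {ω | √(2 * v * t) + c * t ≤ (-X) ω}) := by
        simp only [le_abs, ofPred_or, Pi.neg_apply]
    _ ≤ Real.exp (-t) + Real.exp (-t) := (measureReal_union_le _ _).trans
        (add_le_add (hX.measureReal_ge_le hv hc ht) (hX.neg.measureReal_ge_le hv hc ht))
    _ = 2 * Real.exp (-t) := (two_mul _).symm

end HasSubGammaMGF

end SubGamma

section ExpGrowth

variable {E F : Type*} [NormedAddCommGroup E] [NormedAddCommGroup F]

/-- `f` grows at most exponentially, which makes it integrable for every Gaussian measure. -/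
def ExpBounded (f : E → F) : Prop :=
  ∃ C c : ℝ≥0, ∀ x, ‖f x‖ ≤ C * Real.exp (c * ‖x‖)

/-- `φ` is Lipschitz up to a weight that grows at most exponentially. Unlike Lipschitz functions,
these functions are stable under products and contain the exponentials of Lipschitz functions. -/
def ExpLipschitz (φ : E → ℝ) : Prop :=
  ∃ C c : ℝ≥0, ∀ x y, |φ x - φ y| ≤ C * Real.exp (c * (‖x‖ + ‖y‖)) * ‖x - y‖

theorem norm_le_norm_zero_add_of_lipschitzWith {f : E → F} {C : ℝ≥0}
    (hf : LipschitzWith C f) (x : E) : ‖f x‖ ≤ ‖f 0‖ + C * ‖x‖ := by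
  simpa using (norm_le_norm_add_norm_sub' (f x) (f 0)).trans
    (add_le_add_right (hf.norm_sub_le x 0) _)

theorem abs_exp_sub_exp_le {u v M : ℝ} (hu : u ≤ M) (hv : v ≤ M) :
    |Real.exp u - Real.exp v| ≤ Real.exp M * |u - v| := by
  refine (convex_Iic M).norm_image_sub_le_of_norm_deriv_le
    (fun _ _ ↦ Real.differentiableAt_exp) (fun x hx ↦ ?_) hv hu
  rw [Real.deriv_exp, Real.norm_of_nonneg (Real.exp_pos x).le]
  exact Real.exp_le_exp.2 hx

namespace ExpBounded

variable {f : E → F}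

theorem of_norm_le {G : Type*} [NormedAddCommGroup G] {g : E → G} (hf : ExpBounded f)
    (h : ∀ x, ‖g x‖ ≤ ‖f x‖) : ExpBounded g :=
  let ⟨C, c, hC⟩ := hf
  ⟨C, c, fun x ↦ (h x).trans (hC x)⟩

theorem of_le_add_mul_norm {a b : ℝ} (h : ∀ x, ‖f x‖ ≤ a + b * ‖x‖) : ExpBounded f := by
  refine ⟨a.nnabs + b.nnabs, 1, fun x ↦ (h x).trans ?_⟩
  have h₁ : 1 ≤ Real.exp ‖x‖ := Real.one_le_exp (norm_nonneg x)
  have h₂ : ‖x‖ ≤ Real.exp ‖x‖ := by linarith [Real.add_one_le_exp ‖x‖]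
  calc a + b * ‖x‖ ≤ |a| * 1 + |b| * ‖x‖ := by rw [mul_one]; gcongr <;> exact le_abs_self _
    _ ≤ |a| * Real.exp ‖x‖ + |b| * Real.exp ‖x‖ := by gcongr
    _ = (a.nnabs + b.nnabs : ℝ≥0) * Real.exp ((1 : ℝ≥0) * ‖x‖) := by
        push_cast; rw [one_mul, add_mul]

theorem of_lipschitzWith {C : ℝ≥0} (hf : LipschitzWith C f) : ExpBounded f :=
  of_le_add_mul_norm (norm_le_norm_zero_add_of_lipschitzWith hf)

theorem const (a : F) : ExpBounded (fun _ : E ↦ a) :=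
  of_lipschitzWith (LipschitzWith.const a)

theorem norm (hf : ExpBounded f) : ExpBounded fun x ↦ ‖f x‖ :=
  hf.of_norm_le fun x ↦ (norm_norm (f x)).le

theorem mul {f g : E → ℝ} (hf : ExpBounded f) (hg : ExpBounded g) :
    ExpBounded fun x ↦ f x * g x := by
  obtain ⟨C, c, hf⟩ := hf
  obtain ⟨D, d, hg⟩ := hg
  refine ⟨C * D, c + d, fun x ↦ ?_⟩
  calc ‖f x * g x‖ ≤ C * Real.exp (c * ‖x‖) * (D * Real.exp (d * ‖x‖)) := by
        rw [norm_mul]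
        exact mul_le_mul (hf x) (hg x) (norm_nonneg _) (by positivity)
    _ = (C * D : ℝ≥0) * Real.exp ((c + d : ℝ≥0) * ‖x‖) := by
        push_cast; rw [add_mul, Real.exp_add]; ring

theorem exp {f : E → ℝ} {a b : ℝ} (h : ∀ x, f x ≤ a + b * ‖x‖) :
    ExpBounded fun x ↦ Real.exp (f x) := by
  refine ⟨(Real.exp a).toNNReal, b.nnabs, fun x ↦ ?_⟩
  rw [Real.norm_of_nonneg (Real.exp_pos _).le, Real.coe_toNNReal _ (Real.exp_pos a).le,
    Real.coe_nnabs, ← Real.exp_add]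
  exact Real.exp_le_exp.2 ((h x).trans (by gcongr; exact le_abs_self b))

theorem integrable [NormedSpace ℝ E] [CompleteSpace E] [SecondCountableTopology E]
    [MeasurableSpace E] [BorelSpace E] {μ : Measure E} [IsGaussian μ] (hf : ExpBounded f)
    (hfm : AEStronglyMeasurable f μ) : Integrable f μ := by
  obtain ⟨C, c, hf⟩ := hf
  obtain ⟨a, ha, hexp⟩ := IsGaussian.exists_integrable_exp_sq μ
  refine (hexp.const_mul (C * Real.exp (c ^ 2 / (4 * a)))).mono' hfm (.of_forall fun x ↦ ?_)
  refine (hf x).trans ?_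
  rw [mul_assoc, ← Real.exp_add]
  gcongr
  have young : a * ‖x‖ ^ 2 - c * ‖x‖ + c ^ 2 / (4 * a) = a * (‖x‖ - c / (2 * a)) ^ 2 := by
    field_simp; ring
  nlinarith [sq_nonneg (‖x‖ - c / (2 * a))]

end ExpBounded

namespace ExpLipschitz

variable {φ ψ : E → ℝ}

theorem of_lipschitzWith {C : ℝ≥0} (hφ : LipschitzWith C φ) : ExpLipschitz φ :=
  ⟨C, 0, fun x y ↦ by simpa using hφ.norm_sub_le x y⟩

theorem expBounded (hφ : ExpLipschitz φ) : ExpBounded φ := by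
  obtain ⟨C, c, hφ⟩ := hφ
  have weight : ExpBounded fun x : E ↦ C * Real.exp (c * ‖x‖) * ‖x‖ :=
    ((ExpBounded.const (C : ℝ)).mul (.exp (a := 0) fun x ↦ (zero_add _).ge)).mul
      (.of_lipschitzWith lipschitzWith_one_norm)
  obtain ⟨D, d, hD⟩ := weight
  refine ⟨(φ 0).nnabs + D, d, fun x ↦ ?_⟩
  have increment : |φ x - φ 0| ≤ D * Real.exp (d * ‖x‖) :=
    (by simpa using hφ x 0 : _ ≤ C * Real.exp (c * ‖x‖) * ‖x‖).trans ((le_abs_self _).trans (hD x))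
  calc |φ x| ≤ |φ 0| + |φ x - φ 0| := by simpa using abs_add_le (φ 0) (φ x - φ 0)
    _ ≤ |φ 0| * Real.exp (d * ‖x‖) + D * Real.exp (d * ‖x‖) := by
        gcongr
        exact le_mul_of_one_le_right (abs_nonneg _) (Real.one_le_exp (by positivity))
    _ = ((φ 0).nnabs + D : ℝ≥0) * Real.exp (d * ‖x‖) := by
        push_cast; rw [add_mul]

theorem continuous (hφ : ExpLipschitz φ) : Continuous φ := by
  obtain ⟨C, c, hφ⟩ := hφ
  refine continuous_iff_continuousAt.2 fun x ↦ tendsto_iff_norm_sub_tendsto_zero.2 ?_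
  refine squeeze_zero (fun _ ↦ norm_nonneg _) (fun y ↦ hφ y x) ?_
  exact Continuous.tendsto' (by fun_prop) x 0 (by simp)

theorem norm_fderiv_expBounded [NormedSpace ℝ E] (hφ : ExpLipschitz φ) :
    ExpBounded fun x ↦ ‖fderiv ℝ φ x‖ := by
  obtain ⟨C, c, hφ⟩ := hφ
  have weight : ExpBounded fun x : E ↦ C * Real.exp (c + 2 * c * ‖x‖) :=
    (ExpBounded.const (C : ℝ)).mul (.exp fun x ↦ le_rfl)
  refine weight.of_norm_le fun x ↦ ?_
  rw [norm_norm]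
  refine (norm_fderiv_le_of_lip' ℝ (by positivity) ?_).trans (le_abs_self _)
  filter_upwards [Metric.ball_mem_nhds x one_pos] with y hy
  rw [mem_ball_iff_norm] at hy
  have norm_y_le : ‖y‖ ≤ ‖x‖ + 1 := by linarith [norm_sub_norm_le y x]
  refine (hφ y x).trans ?_
  gcongr C * Real.exp ?_ * _
  nlinarith [c.coe_nonneg]

theorem mul (hφ : ExpLipschitz φ) (hψ : ExpLipschitz ψ) : ExpLipschitz fun x ↦ φ x * ψ x := by
  obtain ⟨A, a, hA⟩ := hφ.expBounded
  obtain ⟨B, b, hB⟩ := hψ.expBounded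
  obtain ⟨C, c, hC⟩ := hφ
  obtain ⟨D, d, hD⟩ := hψ
  refine ⟨A * D + C * B, a + b + c + d, fun x y ↦ ?_⟩
  set S := ‖x‖ + ‖y‖
  set W := Real.exp ((a + b + c + d : ℝ≥0) * S) with hW
  have bound_φ : |φ x| ≤ A * Real.exp (a * S) :=
    (hA x).trans (by gcongr; exact le_add_of_nonneg_right (norm_nonneg y))
  have bound_ψ : |ψ y| ≤ B * Real.exp (b * S) :=
    (hB y).trans (by gcongr; exact le_add_of_nonneg_left (norm_nonneg x))
  have weight_le {u v : ℝ} (h : u + v ≤ a + b + c + d) :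
      Real.exp (u * S) * Real.exp (v * S) ≤ W := by
    rw [← Real.exp_add, ← add_mul, hW]; push_cast; gcongr
  calc |φ x * ψ x - φ y * ψ y| = |φ x * (ψ x - ψ y) + (φ x - φ y) * ψ y| := by congr 1; ring
    _ ≤ |φ x| * |ψ x - ψ y| + |φ x - φ y| * |ψ y| := by
        rw [← abs_mul, ← abs_mul]; exact abs_add_le _ _
    _ ≤ A * Real.exp (a * S) * (D * Real.exp (d * S) * ‖x - y‖) +
          C * Real.exp (c * S) * ‖x - y‖ * (B * Real.exp (b * S)) := by
        gcongr
        exacts [hD x y, hC x y]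
    _ = (A * D * (Real.exp (a * S) * Real.exp (d * S)) +
          C * B * (Real.exp (c * S) * Real.exp (b * S))) * ‖x - y‖ := by ring
    _ ≤ (A * D * W + C * B * W) * ‖x - y‖ := by
        gcongr
        exacts [weight_le (by linarith [b.coe_nonneg, c.coe_nonneg]),
          weight_le (by linarith [a.coe_nonneg, d.coe_nonneg])]
    _ = (A * D + C * B : ℝ≥0) * W * ‖x - y‖ := by push_cast; ring

theorem comp_continuousLinearMap [NormedSpace ℝ E] [NormedSpace ℝ F] (hφ : ExpLipschitz φ)
    (L : F →L[ℝ] E) : ExpLipschitz fun x ↦ φ (L x) := by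
  obtain ⟨C, c, hφ⟩ := hφ
  refine ⟨C * ‖L‖₊, c * ‖L‖₊, fun x y ↦ (hφ _ _).trans ?_⟩
  calc C * Real.exp (c * (‖L x‖ + ‖L y‖)) * ‖L x - L y‖
      ≤ C * Real.exp (c * (‖L‖ * ‖x‖ + ‖L‖ * ‖y‖)) * (‖L‖ * ‖x - y‖) := by
        gcongr
        exacts [L.le_opNorm x, L.le_opNorm y, by rw [← map_sub]; exact L.le_opNorm _]
    _ = (C * ‖L‖₊ : ℝ≥0) * Real.exp ((c * ‖L‖₊ : ℝ≥0) * (‖x‖ + ‖y‖)) * ‖x - y‖ := by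
        push_cast; ring_nf

theorem exp {C : ℝ≥0} (hφ : LipschitzWith C φ) : ExpLipschitz fun x ↦ Real.exp (φ x) := by
  refine ⟨(Real.exp |φ 0|).toNNReal * C, C, fun x y ↦ ?_⟩
  have exponent_le {z : E} (hz : ‖z‖ ≤ ‖x‖ + ‖y‖) : φ z ≤ |φ 0| + C * (‖x‖ + ‖y‖) :=
    ((le_abs_self _).trans (norm_le_norm_zero_add_of_lipschitzWith hφ z)).trans (by
      rw [Real.norm_eq_abs]; gcongr)
  calc |Real.exp (φ x) - Real.exp (φ y)|
      ≤ Real.exp (|φ 0| + C * (‖x‖ + ‖y‖)) * |φ x - φ y| :=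
        abs_exp_sub_exp_le (exponent_le (le_add_of_nonneg_right (norm_nonneg y)))
          (exponent_le (le_add_of_nonneg_left (norm_nonneg x)))
    _ ≤ Real.exp (|φ 0| + C * (‖x‖ + ‖y‖)) * (C * ‖x - y‖) := by
        gcongr; exact hφ.norm_sub_le x y
    _ = ((Real.exp |φ 0|).toNNReal * C : ℝ≥0) * Real.exp (C * (‖x‖ + ‖y‖)) * ‖x - y‖ := by
        rw [NNReal.coe_mul, Real.coe_toNNReal _ (Real.exp_pos _).le, Real.exp_add]; ring

end ExpLipschitz

end ExpGrowth

section Rotation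

variable {E : Type*} [NormedAddCommGroup E] [NormedSpace ℝ E]

theorem norm_smul_add_smul_le (θ : ℝ) (z x : E) :
    ‖Real.cos θ • z + Real.sin θ • x‖ ≤ ‖z‖ + ‖x‖ := by
  refine (norm_add_le _ _).trans ?_
  rw [norm_smul, norm_smul]
  exact add_le_add (mul_le_of_le_one_left (norm_nonneg _) (Real.abs_cos_le_one θ))
    (mul_le_of_le_one_left (norm_nonneg _) (Real.abs_sin_le_one θ))

theorem norm_rotation_le (θ : ℝ) (p : E × E) : ‖ContinuousLinearMap.rotation θ p‖ ≤ 2 * ‖p‖ := by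
  have norm_add_le : ‖p.1‖ + ‖p.2‖ ≤ 2 * ‖p‖ := by linarith [norm_fst_le p, norm_snd_le p]
  have snd_le := norm_smul_add_smul_le (-θ) p.2 p.1
  rw [Real.cos_neg, Real.sin_neg, add_comm, add_comm ‖p.2‖] at snd_le
  exact max_le ((norm_smul_add_smul_le θ p.1 p.2).trans norm_add_le) (snd_le.trans norm_add_le)

theorem norm_smul_add_smul_sub_le (θ θ' : ℝ) (z x : E) :
    ‖(Real.cos θ • z + Real.sin θ • x) - (Real.cos θ' • z + Real.sin θ' • x)‖ ≤
      |θ - θ'| * (‖z‖ + ‖x‖) := by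
  rw [add_sub_add_comm, ← sub_smul, ← sub_smul]
  refine (norm_add_le _ _).trans ?_
  rw [norm_smul, norm_smul, mul_add]
  gcongr
  · exact Real.abs_cos_sub_cos_le ..
  · exact Real.abs_sin_sub_sin_le ..

theorem lipschitzWith_comp_smul_add_smul {f : E → ℝ} {C : ℝ≥0} (hf : LipschitzWith C f)
    (θ : ℝ) (z : E) : LipschitzWith C fun x ↦ f (Real.cos θ • z + Real.sin θ • x) := by
  refine (hf.comp ((LipschitzWith.const (Real.cos θ • z)).add
    (lipschitzWith_smul (Real.sin θ)))).weaken (mul_le_of_le_one_right' ?_)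
  rw [zero_add]
  exact Real.abs_sin_le_one θ

theorem norm_comp_smul_add_smul_sub_le {f : E → ℝ} {C : ℝ≥0} (hf : LipschitzWith C f)
    (θ θ' : ℝ) (z x : E) :
    ‖f (Real.cos θ • z + Real.sin θ • x) - f (Real.cos θ' • z + Real.sin θ' • x)‖ ≤
      C * (‖z‖ + ‖x‖) * |θ - θ'| := by
  refine (hf.norm_sub_le _ _).trans ?_
  rw [mul_assoc, mul_comm (‖z‖ + ‖x‖)]
  gcongr
  exact norm_smul_add_smul_sub_le θ θ' z x

theorem norm_rotation_sub_rotation_le (θ θ' : ℝ) (p : E × E) :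
    ‖ContinuousLinearMap.rotation θ p - ContinuousLinearMap.rotation θ' p‖ ≤
      2 * ‖p‖ * |θ - θ'| := by
  have norm_add_le : ‖p.1‖ + ‖p.2‖ ≤ 2 * ‖p‖ := by linarith [norm_fst_le p, norm_snd_le p]
  have fst_le := norm_smul_add_smul_sub_le θ θ' p.1 p.2
  have snd_le := norm_smul_add_smul_sub_le (-θ) (-θ') p.2 p.1
  rw [neg_sub_neg, abs_sub_comm θ'] at snd_le
  simp only [Real.cos_neg, Real.sin_neg] at snd_le
  have le_rhs : |θ - θ'| * (‖p.1‖ + ‖p.2‖) ≤ 2 * ‖p‖ * |θ - θ'| := by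
    rw [mul_comm]; gcongr
  rw [ContinuousLinearMap.rotation_apply, ContinuousLinearMap.rotation_apply, Prod.mk_sub_mk]
  rw [add_comm ‖p.2‖, add_comm (_ • p.2), add_comm (_ • p.2)] at snd_le
  exact max_le (fst_le.trans le_rhs) (snd_le.trans le_rhs)

theorem hasDerivAt_smul_add_smul (θ : ℝ) (z x : E) :
    HasDerivAt (fun θ ↦ Real.cos θ • z + Real.sin θ • x)
      (-Real.sin θ • z + Real.cos θ • x) θ :=
  ((Real.hasDerivAt_cos θ).smul_const z).add ((Real.hasDerivAt_sin θ).smul_const x)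

theorem hasDerivAt_rotation_zero (p : E × E) :
    HasDerivAt (fun θ ↦ ContinuousLinearMap.rotation θ p) (p.2, -p.1) 0 := by
  have fst := hasDerivAt_smul_add_smul 0 p.1 p.2
  have snd := ((Real.hasDerivAt_sin 0).neg.smul_const p.1).add
    ((Real.hasDerivAt_cos 0).smul_const p.2)
  simpa [ContinuousLinearMap.rotation_apply] using fst.prodMk snd

end Rotation

section StdGaussian

variable {E : Type*} [NormedAddCommGroup E] [InnerProductSpace ℝ E] [FiniteDimensional ℝ E]
  [MeasurableSpace E] [BorelSpace E]

theorem pi_fin_absolutelyContinuous {α : Type*} [MeasurableSpace α] {μ ν : Measure α}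
    [SigmaFinite μ] [SigmaFinite ν] (h : μ ≪ ν) (n : ℕ) :
    Measure.pi (fun _ : Fin n ↦ μ) ≪ Measure.pi (fun _ : Fin n ↦ ν) := by
  induction n with
  | zero => rw [Measure.pi_of_empty, Measure.pi_of_empty]
  | succ n ih =>
    rw [← (measurePreserving_piFinSuccAbove (fun _ : Fin (n + 1) ↦ μ) 0).symm.map_eq,
      ← (measurePreserving_piFinSuccAbove (fun _ : Fin (n + 1) ↦ ν) 0).symm.map_eq]
    exact (h.prod ih).map (MeasurableEquiv.measurable _)

theorem stdGaussian_absolutelyContinuous : stdGaussian E ≪ (volume : Measure E) := by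
  set coords : (Fin (Module.finrank ℝ E) → ℝ) → E :=
    (stdOrthonormalBasis ℝ E).repr.symm ∘ WithLp.toLp 2 with hcoords
  have stdGaussian_eq : stdGaussian E = (Measure.pi fun _ ↦ gaussianReal 0 1).map coords := by
    rw [stdGaussian, hcoords]
    congr 1
    ext x
    simp [OrthonormalBasis.sum_repr_symm]
  have volume_preserving : MeasurePreserving coords volume volume :=
    (stdOrthonormalBasis ℝ E).measurePreserving_repr_symm.comp (PiLp.volume_preserving_toLp _)
  rw [stdGaussian_eq, ← volume_preserving.map_eq]
  exact (pi_fin_absolutelyContinuous (gaussianReal_absolutelyContinuous 0 one_ne_zero) _).map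
    volume_preserving.measurable

theorem ae_stdGaussian_smul_add {c : ℝ} (hc : c ≠ 0) (b : E) {p : E → Prop}
    (h : ∀ᵐ y ∂(volume : Measure E), p y) : ∀ᵐ z ∂stdGaussian E, p (c • z + b) := by
  have smul : Measure.QuasiMeasurePreserving (fun z : E ↦ c • z) volume volume := by
    refine ⟨by fun_prop, ?_⟩
    rw [Measure.map_addHaar_smul _ hc]
    exact Measure.smul_absolutelyContinuous
  exact stdGaussian_absolutelyContinuous.ae_le
    (((measurePreserving_add_right volume b).quasiMeasurePreserving.comp smul).ae h)

theorem measurePreserving_rotation_stdGaussian (θ : ℝ) :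
    MeasurePreserving (ContinuousLinearMap.rotation θ : E × E →L[ℝ] E × E)
      ((stdGaussian E).prod (stdGaussian E)) ((stdGaussian E).prod (stdGaussian E)) :=
  ⟨by fun_prop, IsGaussian.map_rotation_eq_self integral_id_stdGaussian θ⟩

theorem integral_rotation_stdGaussian (θ : ℝ) {Ψ : E × E → ℝ}
    (hΨ : AEStronglyMeasurable Ψ ((stdGaussian E).prod (stdGaussian E))) :
    ∫ p, Ψ (ContinuousLinearMap.rotation θ p) ∂(stdGaussian E).prod (stdGaussian E) =
      ∫ p, Ψ p ∂(stdGaussian E).prod (stdGaussian E) := by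
  have h := measurePreserving_rotation_stdGaussian (E := E) θ
  have := integral_map h.measurable.aemeasurable (h.map_eq.symm ▸ hΨ)
  rwa [h.map_eq, eq_comm] at this

theorem integral_inner_mul_inner_stdGaussian (v w : E) :
    ∫ x, ⟪v, x⟫ * ⟪w, x⟫ ∂stdGaussian E = ⟪v, w⟫ := by
  have h := covarianceBilin_apply (μ := stdGaussian E) IsGaussian.memLp_two_id v w
  rw [covarianceBilin_stdGaussian] at h
  simpa [innerSL_apply_apply ℝ] using h.symm

end StdGaussian

section IntegrationByParts

variable {E : Type*} [NormedAddCommGroup E] [InnerProductSpace ℝ E] [FiniteDimensional ℝ E]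
  [MeasurableSpace E] [BorelSpace E]

theorem ExpLipschitz.ae_differentiableAt {V : Type*} [NormedAddCommGroup V] [NormedSpace ℝ V]
    [FiniteDimensional ℝ V] [MeasurableSpace V] [BorelSpace V] {μ : Measure V}
    [μ.IsAddHaarMeasure] {φ : V → ℝ} (hφ : ExpLipschitz φ) :
    ∀ᵐ x ∂μ, DifferentiableAt ℝ φ x := by
  obtain ⟨C, c, hφ⟩ := hφ
  have on_ball (N : ℕ) : LipschitzOnWith (C * Real.exp (c * (N + N))).toNNReal φ
      (Metric.ball 0 N) := by
    refine LipschitzOnWith.of_dist_le_mul fun x hx y hy ↦ ?_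
    rw [mem_ball_zero_iff] at hx hy
    rw [Real.coe_toNNReal _ (by positivity), dist_eq_norm, dist_eq_norm]
    exact (hφ x y).trans (by gcongr)
  filter_upwards [ae_all_iff.2 fun N ↦ (on_ball N).ae_differentiableWithinAt_of_mem]
    with x hx
  obtain ⟨N, hN⟩ := exists_nat_gt ‖x‖
  have hx_ball : x ∈ Metric.ball 0 (N : ℝ) := mem_ball_zero_iff.2 hN
  exact (hx N hx_ball).differentiableAt (Metric.isOpen_ball.mem_nhds hx_ball)

theorem ExpLipschitz.integrable {V : Type*} [NormedAddCommGroup V] [NormedSpace ℝ V]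
    [CompleteSpace V] [SecondCountableTopology V] [MeasurableSpace V] [BorelSpace V]
    {μ : Measure V} [IsGaussian μ] {φ : V → ℝ} (hφ : ExpLipschitz φ) : Integrable φ μ :=
  hφ.expBounded.integrable hφ.continuous.aestronglyMeasurable

theorem ExpLipschitz.integrable_fderiv_apply {V : Type*} [NormedAddCommGroup V] [NormedSpace ℝ V]
    [FiniteDimensional ℝ V] [MeasurableSpace V] [BorelSpace V] {μ : Measure V} [IsGaussian μ]
    {φ : V → ℝ} (hφ : ExpLipschitz φ) {C : ℝ≥0} {g : V → V} (hg : LipschitzWith C g) :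
    Integrable (fun x ↦ fderiv ℝ φ x (g x)) μ := by
  have := FiniteDimensional.proper ℝ V
  refine ((hφ.norm_fderiv_expBounded.mul (ExpBounded.of_lipschitzWith hg).norm).of_norm_le
    fun x ↦ ?_).integrable ?_
  · exact ((fderiv ℝ φ x).le_opNorm _).trans (le_abs_self _)
  · exact (isBoundedBilinearMap_apply.continuous.measurable.comp
      ((measurable_fderiv ℝ φ).prodMk hg.continuous.measurable)).aestronglyMeasurable

theorem integrable_exp_mul {V : Type*} [NormedAddCommGroup V] [NormedSpace ℝ V]
    [CompleteSpace V] [SecondCountableTopology V] [MeasurableSpace V] [BorelSpace V]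
    {μ : Measure V} [IsGaussian μ] {u F : V → ℝ} {C : ℝ≥0} {a b : ℝ} (hu : LipschitzWith C u)
    (hF : Measurable F) (h : ∀ x, ‖F x‖ ≤ a + b * ‖x‖) :
    Integrable (fun x ↦ Real.exp (u x) * F x) μ :=
  ((ExpLipschitz.exp hu).expBounded.mul (.of_le_add_mul_norm h)).integrable
    (hu.continuous.rexp.measurable.mul hF).aestronglyMeasurable

theorem abs_sub_comp_rotation_le {E : Type*} [NormedAddCommGroup E] [NormedSpace ℝ E]
    {Ψ : E × E → ℝ} {C c : ℝ≥0}
    (hΨ : ∀ p q, |Ψ p - Ψ q| ≤ C * Real.exp (c * (‖p‖ + ‖q‖)) * ‖p - q‖)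
    (θ θ' : ℝ) (p : E × E) :
    |Ψ (ContinuousLinearMap.rotation θ p) - Ψ (ContinuousLinearMap.rotation θ' p)| ≤
      C * Real.exp (4 * c * ‖p‖) * (2 * ‖p‖) * |θ - θ'| := by
  calc _ ≤ C * Real.exp (c * (2 * ‖p‖ + 2 * ‖p‖)) * (2 * ‖p‖ * |θ - θ'|) := by
        refine (hΨ _ _).trans ?_
        gcongr
        exacts [norm_rotation_le θ p, norm_rotation_le θ' p, norm_rotation_sub_rotation_le θ θ' p]
    _ = C * Real.exp (4 * c * ‖p‖) * (2 * ‖p‖) * |θ - θ'| := by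
        rw [← mul_assoc]; congr 4; ring

/-- The derivative at `θ = 0` of `∫ Ψ (rotation θ p)`, which does not depend on `θ`. -/
theorem integral_fderiv_rotation_eq_zero {Ψ : E × E → ℝ} (hΨ : ExpLipschitz Ψ) :
    ∫ p, fderiv ℝ Ψ p (p.2, -p.1) ∂(stdGaussian E).prod (stdGaussian E) = 0 := by
  set γ := (stdGaussian E).prod (stdGaussian E)
  obtain ⟨C, c, hC⟩ := id hΨ
  set bound : E × E → ℝ := fun p ↦ C * Real.exp (4 * c * ‖p‖) * (2 * ‖p‖)
  have bound_integrable : Integrable bound γ := by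
    refine ExpBounded.integrable (((ExpBounded.const (C : ℝ)).mul
      (.exp (a := 0) (b := 4 * c) fun p ↦ (zero_add _).ge)).mul
      (.of_le_add_mul_norm (a := 0) (b := 2) fun p ↦ ?_)) ?_
    · simp
    · exact Continuous.aestronglyMeasurable (by fun_prop)
  have ae_differentiable : ∀ᵐ p ∂γ, DifferentiableAt ℝ Ψ p :=
    (stdGaussian_absolutelyContinuous.prod stdGaussian_absolutelyContinuous).ae_le
      hΨ.ae_differentiableAt
  have deriv := (hasDerivAt_integral_of_dominated_loc_of_lip (𝕜 := ℝ) (μ := γ)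
    (F := fun θ p ↦ Ψ (ContinuousLinearMap.rotation θ p)) (x₀ := 0)
    (F' := fun p ↦ fderiv ℝ Ψ p (p.2, -p.1)) (bound := bound) Filter.univ_mem
    (.of_forall fun θ ↦ (hΨ.continuous.comp (by fun_prop)).aestronglyMeasurable)
    (by simpa [ContinuousLinearMap.rotation_apply] using hΨ.integrable (μ := γ))
    (hΨ.integrable_fderiv_apply
      (LipschitzWith.prod_snd.prodMk LipschitzWith.prod_fst.neg)).aestronglyMeasurable
    (.of_forall fun p ↦ LipschitzOnWith.of_dist_le_mul fun θ _ θ' _ ↦ by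
      rw [dist_eq_norm, dist_eq_norm, Real.coe_nnabs, abs_of_nonneg (by positivity)]
      exact abs_sub_comp_rotation_le hC θ θ' p)
    bound_integrable
    (by
      filter_upwards [ae_differentiable] with p hp
      refine HasFDerivAt.comp_hasDerivAt (0 : ℝ) (l := Ψ) ?_ (hasDerivAt_rotation_zero p)
      simpa [ContinuousLinearMap.rotation_apply] using hp.hasFDerivAt)).2
  have constant (θ : ℝ) : ∫ p, Ψ (ContinuousLinearMap.rotation θ p) ∂γ = ∫ p, Ψ p ∂γ :=
    integral_rotation_stdGaussian θ hΨ.continuous.aestronglyMeasurable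
  simp only [constant] at deriv
  exact deriv.unique (hasDerivAt_const _ _)

theorem fderiv_fst_mul_inner_snd {H : Type*} [NormedAddCommGroup H] [InnerProductSpace ℝ H]
    {φ : H → ℝ} {p : H × H} (hφ : DifferentiableAt ℝ φ p.1)
    (v : H) (w : H × H) :
    fderiv ℝ (fun p : H × H ↦ φ p.1 * ⟪v, p.2⟫) p w =
      fderiv ℝ φ p.1 w.1 * ⟪v, p.2⟫ + φ p.1 * ⟪v, w.2⟫ := by
  have left := hφ.hasFDerivAt.comp p (hasFDerivAt_fst (𝕜 := ℝ) (E := H) (F := H))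
  have right := (innerSL ℝ v).hasFDerivAt.comp p (hasFDerivAt_snd (𝕜 := ℝ) (E := H) (F := H))
  rw [show (fun p : H × H ↦ φ p.1 * ⟪v, p.2⟫) = (φ ∘ Prod.fst) * (innerSL ℝ v ∘ Prod.snd) from rfl,
    (left.mul right).fderiv]
  simp only [Function.comp_apply, coe_innerSL_apply, add_apply, smul_apply,
    ContinuousLinearMap.comp_apply, ContinuousLinearMap.coe_snd', innerSL_apply_apply ℝ,
    smul_eq_mul, ContinuousLinearMap.coe_fst']
  ring

theorem integral_inner_mul_stdGaussian {φ : E → ℝ} (hφ : ExpLipschitz φ) (v : E) :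
    ∫ x, ⟪v, x⟫ * φ x ∂stdGaussian E = ∫ x, fderiv ℝ φ x v ∂stdGaussian E := by
  set γ := stdGaussian E
  have inner_expLipschitz : ExpLipschitz fun x : E ↦ ⟪v, x⟫ :=
    .of_lipschitzWith (innerSL ℝ v).lipschitz
  have product_expLipschitz : ExpLipschitz fun p : E × E ↦ φ p.1 * ⟪v, p.2⟫ :=
    (hφ.comp_continuousLinearMap (.fst ℝ E E)).mul
      (inner_expLipschitz.comp_continuousLinearMap (.snd ℝ E E))
  have fderiv_product : ∀ᵐ p ∂γ.prod γ,
      fderiv ℝ (fun p : E × E ↦ φ p.1 * ⟪v, p.2⟫) p (p.2, -p.1) =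
        fderiv ℝ φ p.1 p.2 * ⟪v, p.2⟫ - ⟪v, p.1⟫ * φ p.1 := by
    filter_upwards [Measure.quasiMeasurePreserving_fst.ae
      (stdGaussian_absolutelyContinuous.ae_le hφ.ae_differentiableAt)] with p hp
    rw [fderiv_fst_mul_inner_snd hp, inner_neg_right]
    ring
  have integrable_right : Integrable (fun p : E × E ↦ ⟪v, p.1⟫ * φ p.1) (γ.prod γ) :=
    (inner_expLipschitz.mul hφ).integrable.comp_fst γ
  have integrable_left : Integrable (fun p : E × E ↦ fderiv ℝ φ p.1 p.2 * ⟪v, p.2⟫)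
      (γ.prod γ) := by
    refine ((product_expLipschitz.integrable_fderiv_apply
      (LipschitzWith.prod_snd.prodMk LipschitzWith.prod_fst.neg)).add
        integrable_right).congr ?_
    filter_upwards [fderiv_product] with p hp
    simp only [Pi.add_apply, Pi.neg_apply, hp, sub_add_cancel]
  have integral_snd (x : E) : ∫ y, fderiv ℝ φ x y * ⟪v, y⟫ ∂γ = fderiv ℝ φ x v := by
    simpa using integral_inner_mul_inner_stdGaussian
      ((InnerProductSpace.toDual ℝ E).symm (fderiv ℝ φ x)) v
  have zero_eq := integral_fderiv_rotation_eq_zero product_expLipschitz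
  rw [integral_congr_ae fderiv_product, integral_sub integrable_left integrable_right,
    integral_prod _ integrable_left, sub_eq_zero,
    integral_fun_fst (fun x ↦ ⟪v, x⟫ * φ x)] at zero_eq
  simpa [integral_snd] using zero_eq.symm

theorem norm_gradient_le_of_lipschitzWith {H : Type*} [NormedAddCommGroup H]
    [InnerProductSpace ℝ H] [CompleteSpace H] {f : H → ℝ} {C : ℝ≥0} (hf : LipschitzWith C f)
    (x : H) : ‖∇ f x‖ ≤ C := by
  rw [gradient, LinearIsometryEquiv.norm_map]
  exact norm_fderiv_le_of_lipschitz ℝ hf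

theorem measurable_gradient (f : E → ℝ) : Measurable (∇ f) :=
  (InnerProductSpace.toDual ℝ E).symm.continuous.measurable.comp (measurable_fderiv ℝ f)

theorem integral_exp_comp_mul_inner {u : E → ℝ} {C : ℝ≥0} (hu : LipschitzWith C u)
    (c : ℝ) (b v : E) :
    ∫ y, Real.exp (u (b + c • y)) * ⟪v, y⟫ ∂stdGaussian E =
      c * ∫ y, Real.exp (u (b + c • y)) * ⟪∇ u (b + c • y), v⟫ ∂stdGaussian E := by
  have lipschitz : LipschitzWith (C * ‖c‖₊) fun y ↦ u (b + c • y) :=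
    hu.comp (by simpa using (LipschitzWith.const b).add (lipschitzWith_smul c))
  have stein := integral_inner_mul_stdGaussian (ExpLipschitz.exp lipschitz) v
  rw [← integral_const_mul, ← integral_congr_ae (.of_forall fun y ↦ mul_comm _ _), stein]
  refine integral_congr_ae ?_
  filter_upwards [stdGaussian_absolutelyContinuous.ae_le
    (lipschitz.ae_differentiableAt (μ := volume))] with y hy
  have chain : fderiv ℝ (fun y ↦ u (b + c • y)) y = c • fderiv ℝ u (b + c • y) := by
    rw [← fderiv_comp_add_left (f := u) b, ← fderiv_comp_smul]
  rw [(hy.hasFDerivAt.exp).fderiv, chain, inner_gradient_left]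
  simp only [smul_apply, smul_eq_mul]
  ring

/-- In the coordinates `(a, b) = rotation θ p`, this is Stein's identity in the variable `b`, since
`p.2 = sin θ • a + cos θ • b`. -/
theorem integral_exp_mul_inner_gradient {u f : E → ℝ} {C D : ℝ≥0} (hu : LipschitzWith C u)
    (hf : LipschitzWith D f) (θ : ℝ) :
    ∫ p, Real.exp (u p.2) * ⟪∇ f (Real.cos θ • p.1 + Real.sin θ • p.2),
        -Real.sin θ • p.1 + Real.cos θ • p.2⟫ ∂(stdGaussian E).prod (stdGaussian E) =
      Real.cos θ * ∫ p, Real.exp (u p.2) *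
        ⟪∇ u p.2, ∇ f (Real.cos θ • p.1 + Real.sin θ • p.2)⟫
          ∂(stdGaussian E).prod (stdGaussian E) := by
  set γ := stdGaussian E
  set x : E × E → E := fun q ↦ Real.sin θ • q.1 + Real.cos θ • q.2
  have x_rotation (p : E × E) : x (ContinuousLinearMap.rotation θ p) = p.2 := by
    simp only [x, ContinuousLinearMap.rotation_apply]
    calc _ = (Real.sin θ ^ 2 + Real.cos θ ^ 2) • p.2 := by module
      _ = p.2 := by rw [Real.sin_sq_add_cos_sq, one_smul]
  have u_x_lipschitz : LipschitzWith (C * (‖Real.sin θ‖₊ * 1 + ‖Real.cos θ‖₊ * 1))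
      fun q ↦ u (x q) :=
    hu.comp (((lipschitzWith_smul (Real.sin θ)).comp LipschitzWith.prod_fst).add
      ((lipschitzWith_smul (Real.cos θ)).comp LipschitzWith.prod_snd))
  have measurable_grad_f : Measurable fun q : E × E ↦ ∇ f q.1 :=
    (measurable_gradient f).comp measurable_fst
  have measurable_grad_u : Measurable fun q : E × E ↦ ∇ u (x q) :=
    (measurable_gradient u).comp (by fun_prop)
  have integrable_left := integrable_exp_mul (μ := γ.prod γ) u_x_lipschitz (a := 0) (b := D)
    (measurable_grad_f.inner measurable_snd) fun q ↦ by
      rw [zero_add]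
      exact (norm_inner_le_norm _ _).trans (mul_le_mul (norm_gradient_le_of_lipschitzWith hf _)
        (norm_snd_le q) (norm_nonneg _) D.2)
  have integrable_right := integrable_exp_mul (μ := γ.prod γ) u_x_lipschitz (a := C * D) (b := 0)
    (measurable_grad_u.inner measurable_grad_f) fun q ↦ by
      rw [zero_mul, add_zero]
      exact (norm_inner_le_norm _ _).trans (mul_le_mul (norm_gradient_le_of_lipschitzWith hu _)
        (norm_gradient_le_of_lipschitzWith hf _) (norm_nonneg _) C.2)
  have rotate_left := integral_rotation_stdGaussian θ integrable_left.aestronglyMeasurable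
  have rotate_right := integral_rotation_stdGaussian θ integrable_right.aestronglyMeasurable
  simp only [x_rotation] at rotate_left rotate_right
  simp only [ContinuousLinearMap.rotation_apply] at rotate_left rotate_right
  rw [rotate_left, rotate_right, integral_prod _ integrable_left, integral_prod _ integrable_right,
    ← integral_const_mul]
  exact integral_congr_ae (.of_forall fun a ↦
    integral_exp_comp_mul_inner hu (Real.cos θ) (Real.sin θ • a) (∇ f a))

end IntegrationByParts

section Mehler

variable {E : Type*} [NormedAddCommGroup E] [InnerProductSpace ℝ E] [FiniteDimensional ℝ E]
  [MeasurableSpace E]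

/-- Mehler's form of the Ornstein–Uhlenbeck semigroup, at the time `t` with `exp (-t) = sin θ`:
it moves from the mean of `f` at `θ = 0` to `f` itself at `θ = π / 2`. -/
noncomputable def mehler (f : E → ℝ) (θ : ℝ) (x : E) : ℝ :=
  ∫ z, f (Real.cos θ • z + Real.sin θ • x) ∂stdGaussian E

/-- The Mehler average of the gradient of `f`; the gradient of `mehler f θ` is
`sin θ • mehlerGradient f θ`. -/
noncomputable def mehlerGradient (f : E → ℝ) (θ : ℝ) (x : E) : E :=
  ∫ z, ∇ f (Real.cos θ • z + Real.sin θ • x) ∂stdGaussian E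

/-- The derivative of `mehler f θ x` with respect to the angle `θ`. -/
noncomputable def mehlerAngleDeriv (f : E → ℝ) (θ : ℝ) (x : E) : ℝ :=
  ∫ z, ⟪∇ f (Real.cos θ • z + Real.sin θ • x), -Real.sin θ • z + Real.cos θ • x⟫ ∂stdGaussian E

theorem mehler_zero (f : E → ℝ) (x : E) : mehler f 0 x = ∫ z, f z ∂stdGaussian E := by
  simp [mehler]

variable [BorelSpace E]

theorem integrable_norm_stdGaussian : Integrable (fun z : E ↦ ‖z‖) (stdGaussian E) :=
  (ExpBounded.of_lipschitzWith lipschitzWith_one_norm).integrable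
    continuous_norm.aestronglyMeasurable

theorem mehler_pi_div_two (f : E → ℝ) (x : E) : mehler f (Real.pi / 2) x = f x := by
  simp [mehler]

theorem measurable_mehlerAngleDeriv (f : E → ℝ) (θ : ℝ) : Measurable (mehlerAngleDeriv f θ) := by
  refine (StronglyMeasurable.integral_prod_left' (f := fun p : E × E ↦
    ⟪∇ f (Real.cos θ • p.1 + Real.sin θ • p.2), -Real.sin θ • p.1 + Real.cos θ • p.2⟫)
    (Measurable.stronglyMeasurable ?_)).measurable
  exact ((measurable_gradient f).comp (by fun_prop)).inner (by fun_prop)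

section Lipschitz

variable {f g : E → ℝ} {C D : ℝ≥0}

theorem integrable_comp_smul_add_smul (hf : LipschitzWith C f) (θ : ℝ) (x : E) :
    Integrable (fun z ↦ f (Real.cos θ • z + Real.sin θ • x)) (stdGaussian E) :=
  (ExpLipschitz.of_lipschitzWith (hf.comp
    ((lipschitzWith_smul (Real.cos θ)).add (.const (Real.sin θ • x))))).integrable

theorem mehler_linear (hf : LipschitzWith C f) (hg : LipschitzWith D g) (a b : ℝ) (θ : ℝ) (x : E) :
    mehler (fun y ↦ a * f y + b * g y) θ x = a * mehler f θ x + b * mehler g θ x := by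
  rw [mehler, integral_add ((integrable_comp_smul_add_smul hf θ x).const_mul a)
    ((integrable_comp_smul_add_smul hg θ x).const_mul b), integral_const_mul, integral_const_mul]
  rfl

theorem lipschitzWith_mehler (hf : LipschitzWith C f) (θ : ℝ) : LipschitzWith C (mehler f θ) := by
  refine LipschitzWith.of_dist_le_mul fun x y ↦ ?_
  rw [dist_eq_norm, dist_eq_norm, mehler, mehler, ← integral_sub
    (integrable_comp_smul_add_smul hf θ x) (integrable_comp_smul_add_smul hf θ y)]
  exact (norm_integral_le_of_norm_le_const (.of_forall fun z ↦
    (lipschitzWith_comp_smul_add_smul hf θ z).norm_sub_le x y)).trans_eq (by simp)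

theorem abs_mehler_sub_mehler_le (hf : LipschitzWith C f) (θ θ' : ℝ) (x : E) :
    |mehler f θ x - mehler f θ' x| ≤
      C * ((∫ z : E, ‖z‖ ∂stdGaussian E) + ‖x‖) * |θ - θ'| := by
  have bound_integrable : Integrable (fun z : E ↦ C * (‖z‖ + ‖x‖) * |θ - θ'|) (stdGaussian E) :=
    ((integrable_norm_stdGaussian.add (integrable_const _)).const_mul _).mul_const _
  rw [mehler, mehler, ← integral_sub (integrable_comp_smul_add_smul hf θ x)
    (integrable_comp_smul_add_smul hf θ' x)]
  refine (norm_integral_le_of_norm_le bound_integrable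
    (.of_forall fun z ↦ norm_comp_smul_add_smul_sub_le hf θ θ' z x)).trans_eq ?_
  rw [integral_mul_const, integral_const_mul,
    integral_add integrable_norm_stdGaussian (integrable_const _)]
  simp

theorem ae_hasGradientAt_smul_add_smul (hf : LipschitzWith C f) {θ : ℝ} (hθ : Real.cos θ ≠ 0)
    (x : E) : ∀ᵐ z ∂stdGaussian E,
      HasGradientAt f (∇ f (Real.cos θ • z + Real.sin θ • x)) (Real.cos θ • z + Real.sin θ • x) :=
  ae_stdGaussian_smul_add hθ (Real.sin θ • x)
    (hf.ae_differentiableAt.mono fun _ hy ↦ hy.hasGradientAt)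

theorem measurable_gradient_smul_add_smul (f : E → ℝ) (θ : ℝ) (x : E) :
    Measurable fun z ↦ ∇ f (Real.cos θ • z + Real.sin θ • x) :=
  (measurable_gradient f).comp (by fun_prop)

theorem integrable_gradient_smul_add_smul (hf : LipschitzWith C f) (θ : ℝ) (x : E) :
    Integrable (fun z ↦ ∇ f (Real.cos θ • z + Real.sin θ • x)) (stdGaussian E) :=
  .of_bound (measurable_gradient_smul_add_smul f θ x).aestronglyMeasurable C
    (.of_forall fun _ ↦ norm_gradient_le_of_lipschitzWith hf _)

theorem hasDerivAt_mehler (hf : LipschitzWith C f) {θ : ℝ} (hθ : Real.cos θ ≠ 0) (x : E) :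
    HasDerivAt (fun θ ↦ mehler f θ x) (mehlerAngleDeriv f θ x) θ := by
  refine (hasDerivAt_integral_of_dominated_loc_of_lip (𝕜 := ℝ)
    (bound := fun z ↦ C * (‖z‖ + ‖x‖)) Filter.univ_mem
    (.of_forall fun θ ↦ (integrable_comp_smul_add_smul hf θ x).aestronglyMeasurable)
    (integrable_comp_smul_add_smul hf θ x)
    ((measurable_gradient_smul_add_smul f θ x).inner (by fun_prop)).aestronglyMeasurable
    (.of_forall fun z ↦ ?_)
    ((integrable_norm_stdGaussian.add (integrable_const _)).const_mul _) ?_).2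
  · refine LipschitzOnWith.of_dist_le_mul fun θ _ θ' _ ↦ ?_
    rw [dist_eq_norm, dist_eq_norm, Real.coe_nnabs, abs_of_nonneg (by positivity)]
    exact norm_comp_smul_add_smul_sub_le hf θ θ' z x
  · filter_upwards [ae_hasGradientAt_smul_add_smul hf hθ x] with z hz
    exact hz.hasFDerivAt.comp_hasDerivAt θ (hasDerivAt_smul_add_smul θ z x)

theorem hasGradientAt_mehler (hf : LipschitzWith C f) {θ : ℝ} (hθ : Real.cos θ ≠ 0) (x : E) :
    HasGradientAt (mehler f θ) (Real.sin θ • mehlerGradient f θ x) x := by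
  have gradient_integrable := (integrable_gradient_smul_add_smul hf θ x).smul (Real.sin θ)
  have toDual_integral : InnerProductSpace.toDual ℝ E (Real.sin θ • mehlerGradient f θ x) =
      ∫ z, InnerProductSpace.toDual ℝ E
        (Real.sin θ • ∇ f (Real.cos θ • z + Real.sin θ • x)) ∂stdGaussian E := by
    rw [mehlerGradient, ← integral_smul]
    exact ((innerSL ℝ).integral_comp_comm gradient_integrable).symm
  rw [hasGradientAt_iff_hasFDerivAt, toDual_integral]
  refine (hasFDerivAt_integral_of_dominated_loc_of_lip (𝕜 := ℝ) (bound := fun _ ↦ (C : ℝ))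
    Filter.univ_mem
    (.of_forall fun x ↦ (integrable_comp_smul_add_smul hf θ x).aestronglyMeasurable)
    (integrable_comp_smul_add_smul hf θ x)
    ((innerSL ℝ).integrable_comp gradient_integrable).aestronglyMeasurable
    (.of_forall fun z ↦ ?_) (integrable_const _) ?_).2
  · rw [Real.nnabs_coe]
    exact (lipschitzWith_comp_smul_add_smul hf θ z).lipschitzOnWith
  · filter_upwards [ae_hasGradientAt_smul_add_smul hf hθ x] with z hz
    have inner_fderiv : HasFDerivAt (fun x ↦ Real.cos θ • z + Real.sin θ • x)
        (Real.sin θ • ContinuousLinearMap.id ℝ E) x :=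
      ((hasFDerivAt_id x).const_smul (Real.sin θ)).const_add _
    refine (hz.hasFDerivAt.comp x inner_fderiv).congr_fderiv ?_
    ext v
    simp

theorem integral_exp_mehler_mul_angleDeriv (hf : LipschitzWith C f) {θ : ℝ}
    (hθ : Real.cos θ ≠ 0) :
    ∫ x, Real.exp (mehler f θ x) * mehlerAngleDeriv f θ x ∂stdGaussian E =
      Real.sin θ * Real.cos θ *
        ∫ x, Real.exp (mehler f θ x) * ‖mehlerGradient f θ x‖ ^ 2 ∂stdGaussian E := by
  set γ := stdGaussian E
  have mehler_lipschitz := lipschitzWith_mehler hf θ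
  have gradient_mehler (x : E) : ∇ (mehler f θ) x = Real.sin θ • mehlerGradient f θ x :=
    (hasGradientAt_mehler hf hθ x).gradient
  have weight_lipschitz : LipschitzWith (C * 1) fun p : E × E ↦ mehler f θ p.2 :=
    mehler_lipschitz.comp LipschitzWith.prod_snd
  have measurable_mehler : Measurable fun p : E × E ↦ ∇ (mehler f θ) p.2 :=
    (measurable_gradient _).comp measurable_snd
  have measurable_average :
      Measurable fun p : E × E ↦ ∇ f (Real.cos θ • p.1 + Real.sin θ • p.2) :=
    (measurable_gradient f).comp (by fun_prop)
  have measurable_velocity : Measurable fun p : E × E ↦ -Real.sin θ • p.1 + Real.cos θ • p.2 := by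
    fun_prop
  have integrable_left := integrable_exp_mul (μ := γ.prod γ) weight_lipschitz (a := 0) (b := C * 2)
    (measurable_average.inner measurable_velocity) fun p ↦ by
      rw [zero_add, mul_assoc]
      exact (norm_inner_le_norm _ _).trans (mul_le_mul (norm_gradient_le_of_lipschitzWith hf _)
        ((norm_snd_le _).trans (norm_rotation_le θ p)) (norm_nonneg _) C.2)
  have integrable_right := integrable_exp_mul (μ := γ.prod γ) weight_lipschitz (a := C * C) (b := 0)
    (measurable_mehler.inner measurable_average) fun p ↦ by
      rw [zero_mul, add_zero]
      exact (norm_inner_le_norm _ _).trans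
        (mul_le_mul (norm_gradient_le_of_lipschitzWith mehler_lipschitz _)
          (norm_gradient_le_of_lipschitzWith hf _) (norm_nonneg _) C.2)
  have inner_average (x : E) :
      ∫ z, ⟪∇ (mehler f θ) x, ∇ f (Real.cos θ • z + Real.sin θ • x)⟫ ∂γ =
        Real.sin θ * ‖mehlerGradient f θ x‖ ^ 2 := by
    rw [integral_inner (integrable_gradient_smul_add_smul hf θ x), gradient_mehler,
      real_inner_smul_left, ← real_inner_self_eq_norm_sq]
    rfl
  have by_parts := integral_exp_mul_inner_gradient mehler_lipschitz hf θ
  rw [integral_prod_symm _ integrable_left, integral_prod_symm _ integrable_right] at by_parts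
  simp only [integral_const_mul, inner_average, mul_left_comm (Real.exp _)] at by_parts
  rw [mul_comm (Real.sin θ), mul_assoc]
  exact by_parts

end Lipschitz

end Mehler

section ParametricIntegral

variable {E : Type*} [NormedAddCommGroup E]

/-- `u θ x` is bounded, and Lipschitz in the parameter `θ`, with constants growing at most linearly
in `x`. This dominates the increments of `θ ↦ exp (u θ x)` by a Gaussian-integrable function. -/
def LinearGrowthFamily (u : ℝ → E → ℝ) : Prop :=
  ∃ K : ℝ≥0, (∀ θ x, |u θ x| ≤ K * (1 + ‖x‖)) ∧
    ∀ θ θ' x, |u θ x - u θ' x| ≤ K * (1 + ‖x‖) * |θ - θ'|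

namespace LinearGrowthFamily

variable {u v : ℝ → E → ℝ}

theorem add (hu : LinearGrowthFamily u) (hv : LinearGrowthFamily v) :
    LinearGrowthFamily fun θ x ↦ u θ x + v θ x := by
  obtain ⟨K, hK, hK'⟩ := hu
  obtain ⟨L, hL, hL'⟩ := hv
  refine ⟨K + L, fun θ x ↦ ?_, fun θ θ' x ↦ ?_⟩
  · refine (abs_add_le _ _).trans ((add_le_add (hK θ x) (hL θ x)).trans_eq ?_)
    push_cast; ring
  · rw [add_sub_add_comm]
    refine (abs_add_le _ _).trans ((add_le_add (hK' θ θ' x) (hL' θ θ' x)).trans_eq ?_)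
    push_cast; ring

theorem mul_left {b : ℝ → ℝ} {M L : ℝ≥0} (hb : ∀ θ, |b θ| ≤ M) (hb' : LipschitzWith L b)
    (hu : LinearGrowthFamily u) : LinearGrowthFamily fun θ x ↦ b θ * u θ x := by
  obtain ⟨K, hK, hK'⟩ := hu
  refine ⟨(M + L) * K, fun θ x ↦ ?_, fun θ θ' x ↦ ?_⟩
  · rw [abs_mul]
    calc |b θ| * |u θ x| ≤ (M + L) * (K * (1 + ‖x‖)) := by
          gcongr
          exacts [(hb θ).trans (le_add_of_nonneg_right L.2), hK θ x]
      _ = _ := by push_cast; ring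
  · calc |b θ * u θ x - b θ' * u θ' x|
        = |b θ * (u θ x - u θ' x) + (b θ - b θ') * u θ' x| := by congr 1; ring
      _ ≤ |b θ| * |u θ x - u θ' x| + |b θ - b θ'| * |u θ' x| := by
          rw [← abs_mul, ← abs_mul]; exact abs_add_le _ _
      _ ≤ M * (K * (1 + ‖x‖) * |θ - θ'|) + L * |θ - θ'| * (K * (1 + ‖x‖)) := by
          gcongr
          exacts [hb θ, hK' θ θ' x, hb'.norm_sub_le θ θ', hK θ' x]
      _ = _ := by push_cast; ring

variable [NormedSpace ℝ E] [CompleteSpace E] [SecondCountableTopology E] [MeasurableSpace E]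
  [BorelSpace E] {μ : Measure E} [IsGaussian μ]

theorem continuous_integral_exp (hu : LinearGrowthFamily u) (hc : ∀ θ, Continuous (u θ)) :
    Continuous fun θ ↦ ∫ x, Real.exp (u θ x) ∂μ := by
  obtain ⟨K, hK, hK'⟩ := hu
  refine continuous_of_dominated (bound := fun x ↦ Real.exp (K * (1 + ‖x‖)))
    (fun θ ↦ (hc θ).rexp.aestronglyMeasurable) (fun θ ↦ .of_forall fun x ↦ ?_)
    ((ExpBounded.exp (a := K) (b := K) fun x ↦ by rw [mul_one_add]).integrable
      (by fun_prop)) (.of_forall fun x ↦ ?_)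
  · rw [Real.norm_of_nonneg (Real.exp_pos _).le]
    exact Real.exp_le_exp.2 ((le_abs_self _).trans (hK θ x))
  · have lipschitz : LipschitzWith (K * (1 + ‖x‖₊)) fun θ ↦ u θ x :=
      .of_dist_le_mul fun θ θ' ↦ hK' θ θ' x
    exact lipschitz.continuous.rexp

theorem hasDerivAt_integral_exp (hu : LinearGrowthFamily u) (hc : ∀ θ, Continuous (u θ))
    {θ : ℝ} {u' : E → ℝ} (hu' : Measurable u') (hd : ∀ x, HasDerivAt (fun θ ↦ u θ x) (u' x) θ) :
    HasDerivAt (fun θ ↦ ∫ x, Real.exp (u θ x) ∂μ) (∫ x, Real.exp (u θ x) * u' x ∂μ) θ := by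
  obtain ⟨K, hK, hK'⟩ := hu
  have exp_integrable : Integrable (fun x ↦ Real.exp (u θ x)) μ :=
    (ExpBounded.exp (a := K) (b := K) fun x ↦ by
      rw [← mul_one_add]; exact (le_abs_self _).trans (hK θ x)).integrable
      (hc θ).rexp.aestronglyMeasurable
  have bound_integrable : Integrable (fun x ↦ Real.exp (K * (1 + ‖x‖)) * (K * (1 + ‖x‖))) μ :=
    ((ExpBounded.exp (a := K) (b := K) fun x ↦ by rw [mul_one_add]).mul
      (.of_le_add_mul_norm (a := K) (b := K) fun x ↦ by
        rw [Real.norm_of_nonneg (by positivity), mul_one_add])).integrable (by fun_prop)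
  refine (hasDerivAt_integral_of_dominated_loc_of_lip (𝕜 := ℝ)
    (bound := fun x ↦ Real.exp (K * (1 + ‖x‖)) * (K * (1 + ‖x‖))) Filter.univ_mem
    (.of_forall fun θ ↦ (hc θ).rexp.aestronglyMeasurable) exp_integrable
    ((hc θ).rexp.measurable.mul hu').aestronglyMeasurable (.of_forall fun x ↦ ?_)
    bound_integrable (.of_forall fun x ↦ (hd x).exp)).2
  refine LipschitzOnWith.of_dist_le_mul fun θ _ θ' _ ↦ ?_
  rw [dist_eq_norm, dist_eq_norm, Real.coe_nnabs, abs_of_nonneg (by positivity)]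
  refine (abs_exp_sub_exp_le ((le_abs_self _).trans (hK θ x))
    ((le_abs_self _).trans (hK θ' x))).trans ?_
  rw [mul_assoc]
  gcongr
  exact hK' θ θ' x

end LinearGrowthFamily

end ParametricIntegral

section Interpolation

/-- The solution `b` of `b' = -4 sin θ cos θ b²` with `b (π / 2) = c`. -/
noncomputable def interpolationWeight (c θ : ℝ) : ℝ :=
  c / (1 - 2 * c * Real.cos θ ^ 2)

theorem interpolationWeight_zero (c : ℝ) : interpolationWeight c 0 = c / (1 - 2 * c) := by
  simp [interpolationWeight]

theorem interpolationWeight_pi_div_two (c : ℝ) : interpolationWeight c (Real.pi / 2) = c := by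
  simp [interpolationWeight]

section Weight

variable {c : ℝ}

theorem one_sub_two_mul_le (hc : 0 ≤ c) (θ : ℝ) : 1 - 2 * c ≤ 1 - 2 * c * Real.cos θ ^ 2 := by
  nlinarith [Real.cos_sq_le_one θ]

variable (hc : 0 ≤ c) (hc' : 2 * c < 1) (θ : ℝ)
include hc hc'

theorem le_interpolationWeight : c ≤ interpolationWeight c θ := by
  have pos : 0 < 1 - 2 * c * Real.cos θ ^ 2 := by
    linarith [one_sub_two_mul_le hc θ]
  rw [interpolationWeight, le_div_iff₀ pos]
  refine mul_le_of_le_one_right hc ?_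
  linarith [show 0 ≤ 2 * c * Real.cos θ ^ 2 by positivity]

theorem interpolationWeight_le : interpolationWeight c θ ≤ c / (1 - 2 * c) :=
  div_le_div_of_nonneg_left hc (by linarith) (one_sub_two_mul_le hc θ)

theorem hasDerivAt_interpolationWeight :
    HasDerivAt (interpolationWeight c)
      (-4 * Real.sin θ * Real.cos θ * interpolationWeight c θ ^ 2) θ := by
  have pos : 0 < 1 - 2 * c * Real.cos θ ^ 2 := by
    linarith [one_sub_two_mul_le hc θ]
  refine ((hasDerivAt_const θ c).div
    ((((Real.hasDerivAt_cos θ).pow 2).const_mul (2 * c)).const_sub 1) pos.ne').congr_deriv ?_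
  simp only [Pi.pow_apply, interpolationWeight]
  field_simp
  push_cast
  ring

theorem lipschitzWith_interpolationWeight :
    LipschitzWith (4 * (c / (1 - 2 * c)) ^ 2).toNNReal (interpolationWeight c) := by
  refine lipschitzWith_of_nnnorm_deriv_le
    (fun θ ↦ (hasDerivAt_interpolationWeight hc hc' θ).differentiableAt) fun θ ↦ ?_
  rw [← NNReal.coe_le_coe, coe_nnnorm, Real.coe_toNNReal _ (by positivity),
    (hasDerivAt_interpolationWeight hc hc' θ).deriv, Real.norm_eq_abs]
  have nonneg := hc.trans (le_interpolationWeight hc hc' θ)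
  calc |-4 * Real.sin θ * Real.cos θ * interpolationWeight c θ ^ 2|
      = 4 * |Real.sin θ| * |Real.cos θ| * interpolationWeight c θ ^ 2 := by
        simp only [abs_mul, abs_neg, Nat.abs_ofNat, abs_pow, sq_abs]
    _ ≤ 4 * 1 * 1 * (c / (1 - 2 * c)) ^ 2 := by
        gcongr
        exacts [Real.abs_sin_le_one θ, Real.abs_cos_le_one θ, interpolationWeight_le hc hc' θ]
    _ = _ := by ring

end Weight

/-- The function whose exponential moment is compared along the Mehler flow: at `θ = π / 2` it is
`l • f`, and the weight of `g` is chosen so that the moment of its Mehler average is monotone. -/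
noncomputable def interpolant {E : Type*} (f g : E → ℝ) (l θ : ℝ) (y : E) : ℝ :=
  l * f y + (interpolationWeight |l| θ - |l|) * g y

theorem lipschitzWith_interpolant {E : Type*} [PseudoMetricSpace E] {f g : E → ℝ} {C D : ℝ≥0}
    (hf : LipschitzWith C f) (hg : LipschitzWith D g) (l θ : ℝ) :
    LipschitzWith (‖l‖₊ * C + ‖interpolationWeight |l| θ - |l|‖₊ * D) (interpolant f g l θ) :=
  ((lipschitzWith_smul l).comp hf).add
    ((lipschitzWith_smul (interpolationWeight |l| θ - |l|)).comp hg)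

theorem norm_gradient_interpolant_sq_le {H : Type*} [NormedAddCommGroup H]
    [InnerProductSpace ℝ H] [CompleteSpace H] {f g : H → ℝ} {y : H} (hg₀ : 0 ≤ g y) {l : ℝ}
    (hl : 2 * |l| < 1) (θ : ℝ) (hf : DifferentiableAt ℝ f y) (hg : DifferentiableAt ℝ g y)
    (hf' : ‖∇ f y‖ ≤ 2 * √(g y)) (hg' : ‖∇ g y‖ ≤ 2 * √(g y)) :
    ‖∇ (interpolant f g l θ) y‖ ^ 2 ≤ 4 * interpolationWeight |l| θ ^ 2 * g y := by
  have weight_ge := le_interpolationWeight (abs_nonneg l) hl θ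
  set b := interpolationWeight |l| θ
  have gradient_eq : ∇ (interpolant f g l θ) y = l • ∇ f y + (b - |l|) • ∇ g y := by
    refine HasGradientAt.gradient (hasGradientAt_iff_hasFDerivAt.2 ?_)
    rw [map_add, map_smul, map_smul]
    exact (hf.hasGradientAt.hasFDerivAt.const_mul l).add
      (hg.hasGradientAt.hasFDerivAt.const_mul (b - |l|))
  have norm_le : ‖∇ (interpolant f g l θ) y‖ ≤ b * (2 * √(g y)) := by
    rw [gradient_eq]
    calc ‖l • ∇ f y + (b - |l|) • ∇ g y‖ ≤ |l| * ‖∇ f y‖ + (b - |l|) * ‖∇ g y‖ := by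
          refine (norm_add_le _ _).trans_eq ?_
          rw [norm_smul, norm_smul, Real.norm_eq_abs, Real.norm_of_nonneg (sub_nonneg.2 weight_ge)]
      _ ≤ |l| * (2 * √(g y)) + (b - |l|) * (2 * √(g y)) := by
          gcongr
      _ = b * (2 * √(g y)) := by ring
  calc ‖∇ (interpolant f g l θ) y‖ ^ 2 ≤ (b * (2 * √(g y))) ^ 2 := by gcongr
    _ = 4 * b ^ 2 * √(g y) ^ 2 := by ring
    _ = 4 * b ^ 2 * g y := by rw [Real.sq_sqrt hg₀]

end Interpolation

section Mgf

variable {E : Type*} [NormedAddCommGroup E] [InnerProductSpace ℝ E] [FiniteDimensional ℝ E]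
  [MeasurableSpace E] [BorelSpace E] {f g : E → ℝ} {C D : ℝ≥0}

theorem norm_mehlerGradient_sq_le (hf : LipschitzWith C f) (hg : LipschitzWith D g) {a : ℝ}
    (h : ∀ᵐ y, ‖∇ f y‖ ^ 2 ≤ a * g y) {θ : ℝ} (hθ : Real.cos θ ≠ 0) (x : E) :
    ‖mehlerGradient f θ x‖ ^ 2 ≤ a * mehler g θ x := by
  have sq_integrable : Integrable
      (fun z ↦ ‖∇ f (Real.cos θ • z + Real.sin θ • x)‖ ^ 2) (stdGaussian E) :=
    .of_bound ((measurable_gradient_smul_add_smul f θ x).norm.pow_const 2).aestronglyMeasurable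
      (C ^ 2) (.of_forall fun z ↦ by
        rw [Real.norm_of_nonneg (by positivity)]
        gcongr
        exact norm_gradient_le_of_lipschitzWith hf _)
  calc ‖mehlerGradient f θ x‖ ^ 2
      ≤ ∫ z, ‖∇ f (Real.cos θ • z + Real.sin θ • x)‖ ^ 2 ∂stdGaussian E :=
        (convexOn_univ_norm.pow (fun _ _ ↦ norm_nonneg _) 2).map_integral_le
          (by fun_prop) isClosed_univ (.of_forall fun _ ↦ mem_univ _)
          (integrable_gradient_smul_add_smul hf θ x) sq_integrable
    _ ≤ ∫ z, a * g (Real.cos θ • z + Real.sin θ • x) ∂stdGaussian E :=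
        integral_mono_ae sq_integrable ((integrable_comp_smul_add_smul hg θ x).const_mul a)
          (ae_stdGaussian_smul_add hθ (Real.sin θ • x) h)
    _ = a * mehler g θ x := integral_const_mul ..

theorem abs_mehler_le (hf : LipschitzWith C f) (θ : ℝ) (x : E) :
    |mehler f θ x| ≤ |f 0| + C * ((∫ z : E, ‖z‖ ∂stdGaussian E) + ‖x‖) := by
  have norm_le (z : E) : ‖f (Real.cos θ • z + Real.sin θ • x)‖ ≤ |f 0| + C * ‖x‖ + C * ‖z‖ := by
    refine (norm_le_norm_zero_add_of_lipschitzWith hf _).trans ?_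
    rw [Real.norm_eq_abs, add_assoc, ← mul_add, add_comm ‖x‖]
    gcongr
    exact norm_smul_add_smul_le θ z x
  refine (norm_integral_le_of_norm_le
    ((integrable_const _).add (integrable_norm_stdGaussian.const_mul _))
    (.of_forall norm_le)).trans_eq ?_
  rw [integral_add' (integrable_const _) (integrable_norm_stdGaussian.const_mul _),
    integral_const_mul, integral_const, probReal_univ, one_smul]
  ring

theorem linearGrowthFamily_mehler (hf : LipschitzWith C f) : LinearGrowthFamily (mehler f) := by
  set M : ℝ≥0 := ⟨∫ z : E, ‖z‖ ∂stdGaussian E, integral_nonneg fun _ ↦ norm_nonneg _⟩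
  have increment_le (θ θ' : ℝ) (x : E) :
      |mehler f θ x - mehler f θ' x| ≤ C * (M + ‖x‖) * |θ - θ'| :=
    abs_mehler_sub_mehler_le hf θ θ' x
  have value_le (θ : ℝ) (x : E) : |mehler f θ x| ≤ ‖f 0‖₊ + C * (M + ‖x‖) := abs_mehler_le hf θ x
  have affine_le (x : E) : ‖f 0‖₊ + C * (M + ‖x‖) ≤ ↑(‖f 0‖₊ + C * (M + 1)) * (1 + ‖x‖) := by
    have h : ‖f 0‖₊ + C * (M + ‖x‖₊) ≤ (‖f 0‖₊ + C * (M + 1)) * (1 + ‖x‖₊) := by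
      calc _ ≤ ‖f 0‖₊ + C * (M + ‖x‖₊) + (‖f 0‖₊ * ‖x‖₊ + C * M * ‖x‖₊ + C) :=
            le_self_add
        _ = _ := by ring
    exact_mod_cast h
  refine ⟨‖f 0‖₊ + C * (M + 1), fun θ x ↦ (value_le θ x).trans (affine_le x),
    fun θ θ' x ↦ (increment_le θ θ' x).trans ?_⟩
  exact mul_le_mul_of_nonneg_right ((le_add_of_nonneg_left ‖f 0‖₊.2).trans (affine_le x))
    (abs_nonneg _)

theorem norm_mehlerAngleDeriv_le (hf : LipschitzWith C f) {θ : ℝ} (hθ : Real.cos θ ≠ 0) (x : E) :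
    ‖mehlerAngleDeriv f θ x‖ ≤ C * (∫ z : E, ‖z‖ ∂stdGaussian E) + C * ‖x‖ := by
  have M_nonneg : 0 ≤ ∫ z : E, ‖z‖ ∂stdGaussian E := integral_nonneg fun _ ↦ norm_nonneg _
  have lipschitz : LipschitzWith (C * (⟨_, M_nonneg⟩ + ‖x‖₊)) fun θ ↦ mehler f θ x :=
    .of_dist_le_mul fun θ θ' ↦ abs_mehler_sub_mehler_le hf θ θ' x
  exact ((hasDerivAt_mehler hf hθ x).le_of_lipschitz lipschitz).trans_eq (mul_add ..)

theorem mehler_interpolant (hf : LipschitzWith C f) (hg : LipschitzWith D g) (l θ θ' : ℝ) (x : E) :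
    mehler (interpolant f g l θ) θ' x =
      l * mehler f θ' x + (interpolationWeight |l| θ - |l|) * mehler g θ' x :=
  mehler_linear hf hg l _ θ' x

theorem linearGrowthFamily_mehler_interpolant (hf : LipschitzWith C f) (hg : LipschitzWith D g)
    {l : ℝ} (hl : 2 * |l| < 1) :
    LinearGrowthFamily fun θ x ↦ mehler (interpolant f g l θ) θ x := by
  simp only [mehler_interpolant hf hg]
  refine ((linearGrowthFamily_mehler hf).mul_left (M := ‖l‖₊) (fun _ ↦ le_rfl) (.const l)).add
    ((linearGrowthFamily_mehler hg).mul_left (M := (|l| / (1 - 2 * |l|)).toNNReal) (fun θ ↦ ?_)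
      ((lipschitzWith_interpolationWeight (abs_nonneg l) hl).sub (.const |l|)))
  have weight_ge := le_interpolationWeight (abs_nonneg l) hl θ
  rw [abs_of_nonneg (sub_nonneg.2 weight_ge)]
  exact (sub_le_self _ (abs_nonneg l)).trans
    ((interpolationWeight_le (abs_nonneg l) hl θ).trans (Real.le_coe_toNNReal _))

theorem hasDerivAt_mehler_interpolant (hf : LipschitzWith C f) (hg : LipschitzWith D g)
    {l : ℝ} (hl : 2 * |l| < 1) {θ : ℝ} (hθ : Real.cos θ ≠ 0) (x : E) :
    HasDerivAt (fun θ ↦ mehler (interpolant f g l θ) θ x)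
      (mehlerAngleDeriv (interpolant f g l θ) θ x +
        -4 * Real.sin θ * Real.cos θ * interpolationWeight |l| θ ^ 2 * mehler g θ x) θ := by
  have split (θ' : ℝ) : mehler (interpolant f g l θ') θ' x =
      mehler (interpolant f g l θ) θ' x +
        (interpolationWeight |l| θ' - interpolationWeight |l| θ) * mehler g θ' x := by
    rw [mehler_interpolant hf hg, mehler_interpolant hf hg]
    ring
  simp only [split]
  refine ((hasDerivAt_mehler (lipschitzWith_interpolant hf hg l θ) hθ x).add
    (((hasDerivAt_interpolationWeight (abs_nonneg l) hl θ).sub_const _).mul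
      (hasDerivAt_mehler hg hθ x))).congr_deriv ?_
  rw [sub_self, zero_mul, add_zero]

theorem integral_exp_mehler_mul_angleDeriv_le (hf : LipschitzWith C f) (hg : LipschitzWith D g)
    {a : ℝ} (h : ∀ᵐ y, ‖∇ f y‖ ^ 2 ≤ a * g y) {θ : ℝ} (hsin : 0 ≤ Real.sin θ)
    (hcos : 0 < Real.cos θ) :
    ∫ x, Real.exp (mehler f θ x) * mehlerAngleDeriv f θ x ∂stdGaussian E ≤
      Real.sin θ * Real.cos θ * a *
        ∫ x, Real.exp (mehler f θ x) * mehler g θ x ∂stdGaussian E := by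
  have integral_le : ∫ x, Real.exp (mehler f θ x) * ‖mehlerGradient f θ x‖ ^ 2 ∂stdGaussian E ≤
      ∫ x, a * (Real.exp (mehler f θ x) * mehler g θ x) ∂stdGaussian E := by
    refine integral_mono_of_nonneg (.of_forall fun x ↦ by positivity) ?_ (.of_forall fun x ↦ ?_)
    · exact (integrable_exp_mul (lipschitzWith_mehler hf θ)
        (lipschitzWith_mehler hg θ).continuous.measurable (norm_le_norm_zero_add_of_lipschitzWith
          (lipschitzWith_mehler hg θ))).const_mul a
    · refine le_of_le_of_eq ?_ (mul_left_comm (Real.exp _) a _)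
      exact mul_le_mul_of_nonneg_left (norm_mehlerGradient_sq_le hf hg h hcos.ne' x)
        (Real.exp_pos _).le
  rw [integral_exp_mehler_mul_angleDeriv hf hcos.ne', mul_assoc _ a,
    ← integral_const_mul a]
  exact mul_le_mul_of_nonneg_left integral_le (mul_nonneg hsin hcos.le)

theorem antitoneOn_integral_exp_mehler_interpolant (hf : LipschitzWith C f)
    (hg : LipschitzWith D g) (hg₀ : ∀ y, 0 ≤ g y) (hf' : ∀ y, ‖∇ f y‖ ≤ 2 * √(g y))
    (hg' : ∀ y, ‖∇ g y‖ ≤ 2 * √(g y)) {l : ℝ} (hl : 2 * |l| < 1) :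
    AntitoneOn (fun θ ↦ ∫ x, Real.exp (mehler (interpolant f g l θ) θ x) ∂stdGaussian E)
      (Icc 0 (Real.pi / 2)) := by
  have continuous_mehler (θ : ℝ) : Continuous (mehler (interpolant f g l θ) θ) :=
    (lipschitzWith_mehler (lipschitzWith_interpolant hf hg l θ) θ).continuous
  have growth := linearGrowthFamily_mehler_interpolant hf hg hl
  have hasDerivAt {θ : ℝ} (hθ : Real.cos θ ≠ 0) :=
    growth.hasDerivAt_integral_exp (μ := stdGaussian E) continuous_mehler
      ((measurable_mehlerAngleDeriv _ θ).add
        ((lipschitzWith_mehler hg θ).continuous.measurable.const_mul _))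
      (hasDerivAt_mehler_interpolant hf hg hl hθ)
  have cos_pos {θ : ℝ} (hθ : θ ∈ Ioo 0 (Real.pi / 2)) : 0 < Real.cos θ :=
    Real.cos_pos_of_mem_Ioo ⟨by linarith [hθ.1, Real.pi_pos], hθ.2⟩
  refine antitoneOn_of_deriv_nonpos (convex_Icc _ _)
    (growth.continuous_integral_exp continuous_mehler).continuousOn ?_ ?_
  · rw [interior_Icc]
    exact fun θ hθ ↦ (hasDerivAt (cos_pos hθ).ne').differentiableAt.differentiableWithinAt
  rw [interior_Icc]
  intro θ hθ
  rw [(hasDerivAt (cos_pos hθ).ne').deriv]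
  have h_lipschitz := lipschitzWith_interpolant hf hg l θ
  have gradient_sq_le : ∀ᵐ y, ‖∇ (interpolant f g l θ) y‖ ^ 2 ≤
      4 * interpolationWeight |l| θ ^ 2 * g y := by
    filter_upwards [hf.ae_differentiableAt, hg.ae_differentiableAt] with y hfy hgy
    exact norm_gradient_interpolant_sq_le (hg₀ y) hl θ hfy hgy (hf' y) (hg' y)
  have deriv_le := integral_exp_mehler_mul_angleDeriv_le h_lipschitz hg gradient_sq_le
    (Real.sin_nonneg_of_nonneg_of_le_pi hθ.1.le (by linarith [hθ.2, Real.pi_pos])) (cos_pos hθ)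
  simp only [Pi.add_apply, mul_add, mul_left_comm (Real.exp _)]
  rw [integral_add, integral_const_mul]
  · linarith
  · exact integrable_exp_mul (lipschitzWith_mehler h_lipschitz θ) (measurable_mehlerAngleDeriv _ θ)
      (norm_mehlerAngleDeriv_le h_lipschitz (cos_pos hθ).ne')
  · exact (integrable_exp_mul (lipschitzWith_mehler h_lipschitz θ)
      (lipschitzWith_mehler hg θ).continuous.measurable
      (norm_le_norm_zero_add_of_lipschitzWith (lipschitzWith_mehler hg θ))).const_mul _

theorem integral_exp_mul_le (hf : LipschitzWith C f) (hg : LipschitzWith D g)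
    (hg₀ : ∀ y, 0 ≤ g y) (hf' : ∀ y, ‖∇ f y‖ ≤ 2 * √(g y)) (hg' : ∀ y, ‖∇ g y‖ ≤ 2 * √(g y))
    {l : ℝ} (hl : 2 * |l| < 1) :
    ∫ x, Real.exp (l * f x) ∂stdGaussian E ≤ Real.exp (l * ∫ x, f x ∂stdGaussian E +
      (|l| / (1 - 2 * |l|) - |l|) * ∫ x, g x ∂stdGaussian E) := by
  have endpoints := antitoneOn_integral_exp_mehler_interpolant hf hg hg₀ hf' hg' hl
    (left_mem_Icc.2 Real.pi_div_two_pos.le) (right_mem_Icc.2 Real.pi_div_two_pos.le)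
    Real.pi_div_two_pos.le
  simpa [mehler_interpolant hf hg, mehler_pi_div_two, mehler_zero, interpolationWeight_pi_div_two,
    interpolationWeight_zero] using endpoints

/-- The gradient condition on `g` closes the estimate: `‖∇ f‖²` is controlled by `g`, and the
same control of `‖∇ g‖²` by `g` makes the exponential moments of `g` finite. -/
theorem hasSubGammaMGF_of_norm_gradient_le (hf : LipschitzWith C f) (hg : LipschitzWith D g)
    (hg₀ : ∀ y, 0 ≤ g y) (hf' : ∀ y, ‖∇ f y‖ ≤ 2 * √(g y)) (hg' : ∀ y, ‖∇ g y‖ ≤ 2 * √(g y)) :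
    HasSubGammaMGF (fun x ↦ f x - ∫ x, f x ∂stdGaussian E) (4 * ∫ x, g x ∂stdGaussian E) 2
      (stdGaussian E) where
  integrable_exp_mul k _ :=
    (ExpLipschitz.exp ((lipschitzWith_smul k).comp (hf.sub (.const _)))).integrable
  mgf_le k hk := by
    have exp_split (x : E) : Real.exp (k * (f x - ∫ x, f x ∂stdGaussian E)) =
        Real.exp (k * f x) * Real.exp (-(k * ∫ x, f x ∂stdGaussian E)) := by
      rw [← Real.exp_add]; congr 1; ring
    simp only [mgf, exp_split]
    rw [integral_mul_const]
    refine (mul_le_mul_of_nonneg_right (integral_exp_mul_le hf hg hg₀ hf' hg' hk)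
      (Real.exp_pos _).le).trans_eq ?_
    rw [← Real.exp_add]
    congr 1
    have ne_zero : 1 - 2 * |k| ≠ 0 := by linarith
    have weight_eq : |k| / (1 - 2 * |k|) - |k| = 4 * k ^ 2 / (2 * (1 - 2 * |k|)) := by
      rw [← sq_abs k, div_sub' ne_zero, div_eq_div_iff ne_zero (mul_ne_zero two_ne_zero ne_zero)]
      ring
    rw [weight_eq]
    ring

theorem abs_sq_norm_sub_sq_norm_le {F V : Type*} [SeminormedAddCommGroup F]
    [SeminormedAddCommGroup V] {d : F → V} (hd : LipschitzWith 1 d) (x y : F) :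
    |‖d x‖ ^ 2 - ‖d y‖ ^ 2| ≤ (‖d x‖ + ‖d y‖) * ‖x - y‖ := by
  rw [sq_sub_sq, abs_mul, abs_of_nonneg (by positivity)]
  gcongr
  exact (abs_norm_sub_norm_le _ _).trans ((hd.norm_sub_le x y).trans_eq (one_mul _))

theorem norm_gradient_sq_norm_le {H V : Type*} [NormedAddCommGroup H] [InnerProductSpace ℝ H]
    [CompleteSpace H] [SeminormedAddCommGroup V] {d : H → V} (hd : LipschitzWith 1 d) (y : H) :
    ‖∇ (fun x ↦ ‖d x‖ ^ 2) y‖ ≤ 2 * ‖d y‖ := by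
  refine le_of_forall_gt_imp_ge_of_dense fun c hc ↦ ?_
  rw [gradient, LinearIsometryEquiv.norm_map]
  refine norm_fderiv_le_of_lip' ℝ ((by positivity : 0 ≤ 2 * ‖d y‖).trans hc.le) ?_
  have near : ∀ᶠ x in 𝓝 y, ‖d x‖ + ‖d y‖ < c :=
    (hd.continuous.norm.add_const ‖d y‖).continuousAt.eventually_lt_const (by linarith)
  filter_upwards [near] with x hx
  exact (abs_sq_norm_sub_sq_norm_le hd x y).trans
    (mul_le_mul_of_nonneg_right hx.le (norm_nonneg _))

theorem hasSubGammaMGF_of_hasGradientAt {d : E → E} {R : ℝ≥0}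
    (hf : ∀ x, HasGradientAt f ((2 : ℝ) • d x) x) (hd : LipschitzWith 1 d) (hR : ∀ x, ‖d x‖ ≤ R) :
    HasSubGammaMGF (fun x ↦ f x - ∫ x, f x ∂stdGaussian E) (4 * ∫ x, ‖d x‖ ^ 2 ∂stdGaussian E) 2
      (stdGaussian E) := by
  have gradient_f (x : E) : ∇ f x = (2 : ℝ) • d x := (hf x).gradient
  have f_lipschitz : LipschitzWith (2 * R) f := by
    refine lipschitzWith_of_nnnorm_fderiv_le (fun x ↦ (hf x).differentiableAt) fun x ↦ ?_
    rw [(hf x).hasFDerivAt.fderiv, LinearIsometryEquiv.nnnorm_map, nnnorm_smul]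
    gcongr
    exacts [by simp, hR x]
  have g_lipschitz : LipschitzWith (2 * R) fun x ↦ ‖d x‖ ^ 2 := by
    refine .of_dist_le_mul fun x y ↦ (abs_sq_norm_sub_sq_norm_le hd x y).trans ?_
    rw [dist_eq_norm, NNReal.coe_mul, NNReal.coe_ofNat, two_mul]
    gcongr
    exacts [hR x, hR y]
  have sqrt_sq (x : E) : √(‖d x‖ ^ 2) = ‖d x‖ := Real.sqrt_sq (norm_nonneg _)
  refine hasSubGammaMGF_of_norm_gradient_le f_lipschitz g_lipschitz (fun _ ↦ by positivity)
    (fun y ↦ ?_) fun y ↦ ?_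
  · rw [gradient_f, norm_smul, Real.norm_ofNat, sqrt_sq]
  · rw [sqrt_sq]
    exact norm_gradient_sq_norm_le hd y

end Mgf

end GaussianConcentration

namespace SeqModel

open GaussianConcentration

variable {n : ℕ} {K : Set (EuclideanSpace ℝ (Fin n))} {μ₀ : EuclideanSpace ℝ (Fin n)}

theorem IsLeastSquares.inner_le_zero {y p q : EuclideanSpace ℝ (Fin n)}
    (hp : IsLeastSquares K y p) (hK : Convex ℝ K) (hq : q ∈ K) : ⟪y - p, q - p⟫ ≤ 0 := by
  have : Nonempty K := ⟨⟨p, hp.1⟩⟩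
  have norm_eq_iInf : ‖y - p‖ = ⨅ w : K, ‖y - w‖ :=
    le_antisymm
      (le_ciInf fun w ↦ (sq_le_sq₀ (norm_nonneg _) (norm_nonneg _)).1 (hp.2 w w.2))
      (ciInf_le ⟨0, by rintro _ ⟨w, rfl⟩; exact norm_nonneg _⟩ (⟨p, hp.1⟩ : K))
  exact (norm_eq_iInf_iff_real_inner_le_zero hK hp.1).1 norm_eq_iInf q hq

theorem IsLeastSquares.norm_sub_sq_le_inner {x y p q : EuclideanSpace ℝ (Fin n)}
    (hp : IsLeastSquares K x p) (hq : IsLeastSquares K y q) (hK : Convex ℝ K) :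
    ‖p - q‖ ^ 2 ≤ ⟪x - y, p - q⟫ := by
  have variational_p := hp.inner_le_zero hK hq.1
  have variational_q := hq.inner_le_zero hK hp.1
  rw [← real_inner_self_eq_norm_sq]
  simp only [inner_sub_left, inner_sub_right] at variational_p variational_q ⊢
  linarith

theorem norm_le_of_norm_sq_le_inner {V : Type*} [SeminormedAddCommGroup V] [InnerProductSpace ℝ V]
    {v w : V} (h : ‖v‖ ^ 2 ≤ ⟪w, v⟫) : ‖v‖ ≤ ‖w‖ := by
  by_contra! hlt
  nlinarith [norm_nonneg v, norm_nonneg w, h.trans (real_inner_le_norm w v)]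

section Projection

variable (hc : IsClosed K) (hK : Convex ℝ K)
include hc hK

theorem isLeastSquares_proj (hne : K.Nonempty) (y : EuclideanSpace ℝ (Fin n)) :
    IsLeastSquares K y (proj K y) :=
  (isLeastSquares_iff_eq_proj hc hK hne y _).2 rfl

theorem lipschitzWith_proj (hne : K.Nonempty) : LipschitzWith 1 (proj K) :=
  .of_dist_le_mul fun x y ↦ by
    rw [dist_eq_norm, dist_eq_norm, NNReal.coe_one, one_mul]
    exact norm_le_of_norm_sq_le_inner ((isLeastSquares_proj hc hK hne x).norm_sub_sq_le_inner
      (isLeastSquares_proj hc hK hne y) hK)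

end Projection

/-- The displacement `Π_K(μ₀ + x) - μ₀` caused by the perturbation `x` of the point `μ₀`; it is
`μ̂_K(σ) - μ₀` for `x = σ h`. -/
noncomputable def displacement (K : Set (EuclideanSpace ℝ (Fin n)))
    (μ₀ x : EuclideanSpace ℝ (Fin n)) : EuclideanSpace ℝ (Fin n) :=
  proj K (μ₀ + x) - μ₀

/-- The likelihood ratio statistic as a function of the perturbation `x` of the point `μ₀`, expanded
so that `‖x‖ ^ 2` cancels. -/
noncomputable def excess (K : Set (EuclideanSpace ℝ (Fin n)))
    (μ₀ x : EuclideanSpace ℝ (Fin n)) : ℝ :=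
  2 * ⟪x, displacement K μ₀ x⟫ - ‖displacement K μ₀ x‖ ^ 2

theorem obs_sub_lse (K : Set (EuclideanSpace ℝ (Fin n))) (μ₀ h : EuclideanSpace ℝ (Fin n)) (σ : ℝ) :
    obs μ₀ σ h - lse K μ₀ σ h = σ • h - displacement K μ₀ (σ • h) := by
  simp only [obs, lse, displacement]
  abel

theorem err_eq (K : Set (EuclideanSpace ℝ (Fin n))) (μ₀ h : EuclideanSpace ℝ (Fin n)) (σ : ℝ) :
    err K μ₀ σ h = ‖displacement K μ₀ (σ • h)‖ ^ 2 := rfl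

theorem lrt_eq (K : Set (EuclideanSpace ℝ (Fin n))) (μ₀ h : EuclideanSpace ℝ (Fin n)) (σ : ℝ) :
    lrt K μ₀ σ h = excess K μ₀ (σ • h) := by
  rw [lrt, obs_sub_lse, obs, add_sub_cancel_left, norm_sub_sq_real, excess]
  ring

theorem excess_le (K : Set (EuclideanSpace ℝ (Fin n))) (μ₀ x : EuclideanSpace ℝ (Fin n)) :
    excess K μ₀ x ≤ ‖x‖ ^ 2 := by
  have expansion := norm_sub_sq_real x (displacement K μ₀ x)
  rw [excess]
  linarith [sq_nonneg ‖x - displacement K μ₀ x‖]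

section Displacement

variable (hc : IsClosed K) (hK : Convex ℝ K) (hμ : μ₀ ∈ K)
include hc hK hμ

theorem lipschitzWith_displacement : LipschitzWith 1 (displacement K μ₀) :=
  .of_dist_le_mul fun x y ↦ by
    rw [displacement, displacement, dist_sub_right, ← dist_add_left μ₀ x y]
    exact (lipschitzWith_proj hc hK ⟨μ₀, hμ⟩).dist_le_mul _ _

theorem norm_displacement_sq_le_inner (x : EuclideanSpace ℝ (Fin n)) :
    ‖displacement K μ₀ x‖ ^ 2 ≤ ⟪x, displacement K μ₀ x⟫ := by
  have self : IsLeastSquares K μ₀ μ₀ := ⟨hμ, fun _ _ ↦ by simp⟩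
  have firm := (isLeastSquares_proj hc hK ⟨μ₀, hμ⟩ (μ₀ + x)).norm_sub_sq_le_inner self hK
  rwa [add_sub_cancel_left] at firm

theorem norm_displacement_le (x : EuclideanSpace ℝ (Fin n)) : ‖displacement K μ₀ x‖ ≤ ‖x‖ :=
  norm_le_of_norm_sq_le_inner (norm_displacement_sq_le_inner hc hK hμ x)

theorem norm_displacement_sq_le_excess (x : EuclideanSpace ℝ (Fin n)) :
    ‖displacement K μ₀ x‖ ^ 2 ≤ excess K μ₀ x := by
  rw [excess]
  linarith [norm_displacement_sq_le_inner hc hK hμ x]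

theorem two_inner_displacement_le (x y : EuclideanSpace ℝ (Fin n)) :
    2 * ⟪y - x, displacement K μ₀ x⟫ ≤ excess K μ₀ y - excess K μ₀ x := by
  have competitor := (isLeastSquares_proj hc hK ⟨μ₀, hμ⟩ (μ₀ + y)).2 _
    (isLeastSquares_proj hc hK ⟨μ₀, hμ⟩ (μ₀ + x)).1
  have residual (w) : μ₀ + y - proj K (μ₀ + w) = y - displacement K μ₀ w := by
    rw [displacement]; abel
  rw [residual, residual, norm_sub_sq_real, norm_sub_sq_real] at competitor
  simp only [excess, inner_sub_left]
  linarith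

theorem excess_sub_le (x y : EuclideanSpace ℝ (Fin n)) :
    excess K μ₀ y - excess K μ₀ x ≤ 2 * ⟪y - x, displacement K μ₀ x⟫ + 2 * ‖y - x‖ ^ 2 := by
  have subgradient := two_inner_displacement_le hc hK hμ y x
  have increment : ⟪y - x, displacement K μ₀ y - displacement K μ₀ x⟫ ≤ ‖y - x‖ * ‖y - x‖ :=
    (real_inner_le_norm _ _).trans (mul_le_mul_of_nonneg_left
      (((lipschitzWith_displacement hc hK hμ).norm_sub_le y x).trans_eq (one_mul _))
      (norm_nonneg _))
  rw [← neg_sub y x, inner_neg_left] at subgradient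
  rw [inner_sub_right] at increment
  linarith

theorem hasGradientAt_excess (x : EuclideanSpace ℝ (Fin n)) :
    HasGradientAt (excess K μ₀) ((2 : ℝ) • displacement K μ₀ x) x := by
  rw [hasGradientAt_iff_isLittleO]
  refine (Asymptotics.IsBigO.of_bound 2 (.of_forall fun y ↦ ?_)).trans_isLittleO
    (Asymptotics.isLittleO_pow_sub_sub x one_lt_two)
  have lower := two_inner_displacement_le hc hK hμ x y
  have upper := excess_sub_le hc hK hμ x y
  rw [real_inner_smul_left, real_inner_comm, Real.norm_of_nonneg (by linarith),
    Real.norm_of_nonneg (by positivity)]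
  linarith

theorem displacement_inter_closedBall {R : ℝ} {x : EuclideanSpace ℝ (Fin n)} (hx : ‖x‖ ≤ R) :
    displacement (K ∩ Metric.closedBall μ₀ R) μ₀ x = displacement K μ₀ x := by
  have minimizer := isLeastSquares_proj hc hK ⟨μ₀, hμ⟩ (μ₀ + x)
  have mem_ball : proj K (μ₀ + x) ∈ Metric.closedBall μ₀ R :=
    mem_closedBall_iff_norm.2 ((norm_displacement_le hc hK hμ x).trans hx)
  have proj_eq : proj K (μ₀ + x) = proj (K ∩ Metric.closedBall μ₀ R) (μ₀ + x) :=
    (isLeastSquares_iff_eq_proj (hc.inter Metric.isClosed_closedBall)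
      (hK.inter (convex_closedBall μ₀ R)) ⟨_, minimizer.1, mem_ball⟩ _ _).1
      ⟨⟨minimizer.1, mem_ball⟩, fun q hq ↦ minimizer.2 q hq.1⟩
  rw [displacement, displacement, proj_eq]

end Displacement

theorem lrt_le (K : Set (EuclideanSpace ℝ (Fin n))) (μ₀ : EuclideanSpace ℝ (Fin n)) (σ : ℝ)
    (h : EuclideanSpace ℝ (Fin n)) : lrt K μ₀ σ h ≤ σ ^ 2 * ‖h‖ ^ 2 := by
  rw [lrt_eq, ← sq_abs σ, ← mul_pow, ← Real.norm_eq_abs, ← norm_smul]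
  exact excess_le K μ₀ _

theorem err_nonneg (K : Set (EuclideanSpace ℝ (Fin n))) (μ₀ : EuclideanSpace ℝ (Fin n)) (σ : ℝ)
    (h : EuclideanSpace ℝ (Fin n)) : 0 ≤ err K μ₀ σ h :=
  sq_nonneg _

theorem meanErr_nonneg (K : Set (EuclideanSpace ℝ (Fin n))) (μ₀ : EuclideanSpace ℝ (Fin n))
    (σ : ℝ) : 0 ≤ meanErr K μ₀ σ :=
  integral_nonneg (err_nonneg K μ₀ σ)

theorem integrable_sq_mul_norm_sq (σ : ℝ) :
    Integrable (fun h : EuclideanSpace ℝ (Fin n) ↦ σ ^ 2 * ‖h‖ ^ 2) (gauss n) :=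
  ((IsGaussian.memLp_two_id (μ := gauss n)).integrable_norm_pow two_ne_zero).const_mul _

section Statistics

variable (hc : IsClosed K) (hK : Convex ℝ K) (hμ : μ₀ ∈ K)
include hc hK hμ

theorem err_le_lrt (σ : ℝ) (h : EuclideanSpace ℝ (Fin n)) : err K μ₀ σ h ≤ lrt K μ₀ σ h := by
  rw [lrt_eq, err_eq]
  exact norm_displacement_sq_le_excess hc hK hμ _

theorem norm_err_le (σ : ℝ) (h : EuclideanSpace ℝ (Fin n)) : ‖err K μ₀ σ h‖ ≤ σ ^ 2 * ‖h‖ ^ 2 := by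
  rw [Real.norm_of_nonneg (err_nonneg K μ₀ σ h)]
  exact (err_le_lrt hc hK hμ σ h).trans (lrt_le K μ₀ σ h)

theorem norm_lrt_le (σ : ℝ) (h : EuclideanSpace ℝ (Fin n)) : ‖lrt K μ₀ σ h‖ ≤ σ ^ 2 * ‖h‖ ^ 2 := by
  rw [Real.norm_of_nonneg ((err_nonneg K μ₀ σ h).trans (err_le_lrt hc hK hμ σ h))]
  exact lrt_le K μ₀ σ h

theorem continuous_excess : Continuous (excess K μ₀) :=
  continuous_iff_continuousAt.2 fun x ↦ (hasGradientAt_excess hc hK hμ x).continuousAt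

theorem continuous_lrt (σ : ℝ) : Continuous (lrt K μ₀ σ) := by
  simp only [funext (lrt_eq K μ₀ · σ)]
  exact (continuous_excess hc hK hμ).comp (continuous_const_smul σ)

theorem continuous_err (σ : ℝ) : Continuous (err K μ₀ σ) := by
  simp only [funext (err_eq K μ₀ · σ)]
  exact ((lipschitzWith_displacement hc hK hμ).continuous.comp (continuous_const_smul σ)).norm.pow 2

theorem integrable_lrt (σ : ℝ) : Integrable (lrt K μ₀ σ) (gauss n) :=
  (integrable_sq_mul_norm_sq σ).mono' (continuous_lrt hc hK hμ σ).aestronglyMeasurable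
    (.of_forall (norm_lrt_le hc hK hμ σ))

theorem integrable_err (σ : ℝ) : Integrable (err K μ₀ σ) (gauss n) :=
  (integrable_sq_mul_norm_sq σ).mono' (continuous_err hc hK hμ σ).aestronglyMeasurable
    (.of_forall (norm_err_le hc hK hμ σ))

end Statistics

section Concentration

theorem hasGradientAt_const_mul_comp_smul {V : Type*} [NormedAddCommGroup V]
    [InnerProductSpace ℝ V] [CompleteSpace V] {f : V → ℝ} {g x : V} {σ : ℝ} (a : ℝ)
    (hf : HasGradientAt f g (σ • x)) :
    HasGradientAt (fun y ↦ a * f (σ • y)) ((a * σ) • g) x := by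
  rw [hasGradientAt_iff_hasFDerivAt] at hf ⊢
  refine ((hf.comp x ((hasFDerivAt_id x).const_smul σ)).const_mul a).congr_fderiv ?_
  ext v
  simp [mul_assoc]

theorem lipschitzWith_inv_smul_comp_smul {V : Type*} [SeminormedAddCommGroup V] [NormedSpace ℝ V]
    {d : V → V} {C : ℝ≥0} (hd : LipschitzWith C d) {σ : ℝ} (hσ : σ ≠ 0) :
    LipschitzWith C fun x ↦ σ⁻¹ • d (σ • x) := by
  have := (lipschitzWith_smul (β := V) σ⁻¹).comp (hd.comp (lipschitzWith_smul (β := V) σ))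
  rwa [mul_comm C, nnnorm_inv, inv_mul_cancel_left₀ (nnnorm_ne_zero_iff.2 hσ)] at this

variable (hc : IsClosed K) (hK : Convex ℝ K) (hμ : μ₀ ∈ K)
include hc hK hμ

theorem hasSubGammaMGF_lrt_of_norm_displacement_le {R : ℝ≥0} (hR : ∀ x, ‖displacement K μ₀ x‖ ≤ R)
    {σ : ℝ} (hσ : σ ≠ 0) :
    HasSubGammaMGF (fun h ↦ lrt K μ₀ σ h - meanLrt K μ₀ σ) (4 * σ ^ 2 * meanErr K μ₀ σ) (2 * σ ^ 2)
      (gauss n) := by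
  set d : EuclideanSpace ℝ (Fin n) → EuclideanSpace ℝ (Fin n) :=
    fun h ↦ σ⁻¹ • displacement K μ₀ (σ • h)
  have gradient_eq h : HasGradientAt (fun h ↦ (σ ^ 2)⁻¹ * lrt K μ₀ σ h) ((2 : ℝ) • d h) h := by
    simp only [lrt_eq]
    convert hasGradientAt_const_mul_comp_smul (σ ^ 2)⁻¹ (hasGradientAt_excess hc hK hμ (σ • h))
      using 1
    rw [smul_smul, smul_smul]
    congr 1
    field_simp
  have norm_d_le h : ‖d h‖ ≤ (‖σ⁻¹‖₊ * R : ℝ≥0) := by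
    rw [norm_smul, NNReal.coe_mul, coe_nnnorm]
    gcongr
    exact hR _
  have norm_d_sq h : ‖d h‖ ^ 2 = (σ ^ 2)⁻¹ * err K μ₀ σ h := by
    rw [norm_smul, mul_pow, err_eq, norm_inv, inv_pow, Real.norm_eq_abs, sq_abs]
  have concentration := (hasSubGammaMGF_of_hasGradientAt gradient_eq
    (lipschitzWith_inv_smul_comp_smul (lipschitzWith_displacement hc hK hμ) hσ) norm_d_le).const_mul
    (σ ^ 2)
  simp only [norm_d_sq, integral_const_mul] at concentration
  convert concentration using 1
  · ext h
    rw [← mul_sub, mul_inv_cancel_left₀ (pow_ne_zero 2 hσ)]; rfl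
  · rw [meanErr]; field_simp
  · rw [abs_of_nonneg (sq_nonneg σ), mul_comm]

theorem norm_displacement_inter_closedBall_le {R : ℝ} (hR : 0 ≤ R) (x : EuclideanSpace ℝ (Fin n)) :
    ‖displacement (K ∩ Metric.closedBall μ₀ R) μ₀ x‖ ≤ R :=
  mem_closedBall_iff_norm.1 (isLeastSquares_proj (hc.inter Metric.isClosed_closedBall)
    (hK.inter (convex_closedBall μ₀ R)) ⟨μ₀, hμ, Metric.mem_closedBall_self hR⟩ (μ₀ + x)).1.2

theorem eventually_displacement_inter_closedBall_eq (x : EuclideanSpace ℝ (Fin n)) :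
    ∀ᶠ N : ℕ in atTop,
      displacement (K ∩ Metric.closedBall μ₀ N) μ₀ x = displacement K μ₀ x := by
  filter_upwards [tendsto_natCast_atTop_atTop.eventually_ge_atTop ‖x‖] with N hN using
    displacement_inter_closedBall hc hK hμ hN

-- Truncating `K` makes the statistic Lipschitz without changing it near a given noise vector.
theorem hasSubGammaMGF_lrt {σ : ℝ} (hσ : σ ≠ 0) :
    HasSubGammaMGF (fun h ↦ lrt K μ₀ σ h - meanLrt K μ₀ σ) (4 * σ ^ 2 * meanErr K μ₀ σ) (2 * σ ^ 2)
      (gauss n) := by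
  let B (N : ℕ) : Set (EuclideanSpace ℝ (Fin n)) := K ∩ Metric.closedBall μ₀ N
  have closed_B N : IsClosed (B N) := hc.inter Metric.isClosed_closedBall
  have convex_B N : Convex ℝ (B N) := hK.inter (convex_closedBall μ₀ N)
  have mem_B N : μ₀ ∈ B N := ⟨hμ, Metric.mem_closedBall_self N.cast_nonneg⟩
  have tendsto_lrt h : Tendsto (fun N ↦ lrt (B N) μ₀ σ h) atTop (𝓝 (lrt K μ₀ σ h)) := by
    refine tendsto_const_nhds.congr' ?_
    filter_upwards [eventually_displacement_inter_closedBall_eq hc hK hμ (σ • h)] with N hN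
    rw [lrt_eq, lrt_eq, excess, excess, hN]
  have tendsto_err h : Tendsto (fun N ↦ err (B N) μ₀ σ h) atTop (𝓝 (err K μ₀ σ h)) := by
    refine tendsto_const_nhds.congr' ?_
    filter_upwards [eventually_displacement_inter_closedBall_eq hc hK hμ (σ • h)] with N hN
    rw [err_eq, err_eq, hN]
  have tendsto_meanLrt : Tendsto (fun N ↦ meanLrt (B N) μ₀ σ) atTop (𝓝 (meanLrt K μ₀ σ)) :=
    tendsto_integral_of_dominated_convergence _
      (fun N ↦ (continuous_lrt (closed_B N) (convex_B N) (mem_B N) σ).aestronglyMeasurable)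
      (integrable_sq_mul_norm_sq σ)
      (fun N ↦ .of_forall (norm_lrt_le (closed_B N) (convex_B N) (mem_B N) σ))
      (.of_forall tendsto_lrt)
  have tendsto_meanErr : Tendsto (fun N ↦ meanErr (B N) μ₀ σ) atTop (𝓝 (meanErr K μ₀ σ)) :=
    tendsto_integral_of_dominated_convergence _
      (fun N ↦ (continuous_err (closed_B N) (convex_B N) (mem_B N) σ).aestronglyMeasurable)
      (integrable_sq_mul_norm_sq σ)
      (fun N ↦ .of_forall (norm_err_le (closed_B N) (convex_B N) (mem_B N) σ))
      (.of_forall tendsto_err)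
  exact .of_tendsto
    (fun N ↦ hasSubGammaMGF_lrt_of_norm_displacement_le (R := N) (closed_B N) (convex_B N) (mem_B N)
      (norm_displacement_inter_closedBall_le hc hK hμ N.cast_nonneg) hσ)
    (fun h ↦ (tendsto_lrt h).sub tendsto_meanLrt) (tendsto_meanErr.const_mul _)

theorem memLp_lrt {σ : ℝ} (hσ : σ ≠ 0) : MemLp (lrt K μ₀ σ) 2 (gauss n) := by
  simpa only [Pi.add_def, sub_add_cancel] using
    (hasSubGammaMGF_lrt hc hK hμ hσ).memLp_two.add (memLp_const (meanLrt K μ₀ σ))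

theorem variance_lrt_le {σ : ℝ} (hσ : σ ≠ 0) :
    variance (lrt K μ₀ σ) (gauss n) ≤ 4 * σ ^ 2 * meanErr K μ₀ σ := by
  rw [← variance_sub_const (continuous_lrt hc hK hμ σ).aestronglyMeasurable]
  exact (hasSubGammaMGF_lrt hc hK hμ hσ).variance_le

theorem measureReal_abs_lrt_sub_ge_le {σ : ℝ} (hσ : σ ≠ 0) {t : ℝ} (ht : 0 ≤ t) :
    (gauss n).real {h | √(σ ^ 2 * meanErr K μ₀ σ * t) + σ ^ 2 * t ≤
      3⁻¹ * |lrt K μ₀ σ h - meanLrt K μ₀ σ|} ≤ 3 * Real.exp (-t / 3) := by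
  have tail := (hasSubGammaMGF_lrt hc hK hμ hσ).measureReal_abs_ge_le
    (mul_nonneg (by positivity) (meanErr_nonneg K μ₀ σ)) (by positivity) ht
  have sqrt_le : √(2 * (4 * σ ^ 2 * meanErr K μ₀ σ) * t) ≤ 3 * √(σ ^ 2 * meanErr K μ₀ σ * t) := by
    rw [← Real.sqrt_sq (zero_le_three (α := ℝ)), ← Real.sqrt_mul (sq_nonneg 3)]
    apply Real.sqrt_le_sqrt
    nlinarith [mul_nonneg (mul_nonneg (sq_nonneg σ) (meanErr_nonneg K μ₀ σ)) ht]
  have exp_le : Real.exp (-t) ≤ Real.exp (-t / 3) := Real.exp_le_exp.2 (by linarith)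
  calc (gauss n).real {h | √(σ ^ 2 * meanErr K μ₀ σ * t) + σ ^ 2 * t ≤
          3⁻¹ * |lrt K μ₀ σ h - meanLrt K μ₀ σ|}
      ≤ (gauss n).real {h | √(2 * (4 * σ ^ 2 * meanErr K μ₀ σ) * t) + 2 * σ ^ 2 * t ≤
          |lrt K μ₀ σ h - meanLrt K μ₀ σ|} := by
        refine measureReal_mono fun h hh ↦ ?_
        simp only [mem_ofPred_eq] at hh ⊢
        nlinarith [mul_nonneg (sq_nonneg σ) ht]
    _ ≤ 2 * Real.exp (-t) := tail
    _ ≤ 3 * Real.exp (-t / 3) := by linarith [Real.exp_pos (-t / 3)]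

theorem integral_exp_standardized_lrt_le {σ : ℝ} (hσ : 0 < σ) {l : ℝ}
    (hl : l ^ 2 < meanErr K μ₀ σ / (8 * σ ^ 2)) :
    Integrable (fun h ↦ Real.exp (l * ((lrt K μ₀ σ h - meanLrt K μ₀ σ) /
        (σ * √(meanErr K μ₀ σ))))) (gauss n) ∧
    ∫ h, Real.exp (l * ((lrt K μ₀ σ h - meanLrt K μ₀ σ) / (σ * √(meanErr K μ₀ σ)))) ∂gauss n ≤
      Real.exp (4 * l ^ 2 / (1 - 8 * (σ ^ 2 / meanErr K μ₀ σ) * l ^ 2)) := by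
  set m := meanErr K μ₀ σ
  have hm : 0 < m := pos_of_mul_pos_left
    ((sq_nonneg l).trans_lt hl) (by positivity : (0 : ℝ) ≤ (8 * σ ^ 2)⁻¹)
  set k := l / (σ * √m) with hk
  have sq_eq : (σ ^ 2 * |k|) ^ 2 = σ ^ 2 / m * l ^ 2 := by
    rw [mul_pow, sq_abs, hk, div_pow, mul_pow, Real.sq_sqrt hm.le]
    field_simp
  have small : 8 * (σ ^ 2 * |k|) ^ 2 < 1 := by
    rw [lt_div_iff₀ (by positivity)] at hl
    rw [sq_eq, div_mul_eq_mul_div, ← mul_div_assoc, div_lt_one hm]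
    linarith
  have mul_abs_lt : 2 * σ ^ 2 * |k| < 1 := by
    nlinarith [sq_nonneg (σ ^ 2 * |k|)]
  have exponent (h) : l * ((lrt K μ₀ σ h - meanLrt K μ₀ σ) / (σ * √m)) =
      k * (lrt K μ₀ σ h - meanLrt K μ₀ σ) := by
    rw [hk]; ring
  simp only [exponent]
  have concentration := hasSubGammaMGF_lrt hc hK hμ hσ.ne'
  refine ⟨concentration.integrable_exp_mul k mul_abs_lt,
    (concentration.mgf_le k mul_abs_lt).trans (Real.exp_le_exp.2 ?_)⟩
  have numerator : 4 * σ ^ 2 * m * k ^ 2 = 4 * l ^ 2 := by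
    rw [hk, div_pow, mul_pow, Real.sq_sqrt hm.le]
    field_simp
  rw [numerator, mul_assoc 8, ← sq_eq]
  refine div_le_div_of_nonneg_left (by positivity) (by linarith) ?_
  nlinarith [sq_nonneg (1 - 4 * (σ ^ 2 * |k|))]

end Concentration

section Divergence

variable {F : EuclideanSpace ℝ (Fin n) → EuclideanSpace ℝ (Fin n)} {C : ℝ≥0}

theorem lipschitzWith_apply (hF : LipschitzWith C F) (i : Fin n) :
    LipschitzWith C fun z ↦ F z i :=
  .of_dist_le_mul fun x y ↦ (dist_eq_norm (F x i) (F y i)).trans_le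
    ((PiLp.norm_apply_le (F x - F y) i).trans (dist_eq_norm (F x) (F y) ▸ hF.dist_le_mul x y))

theorem divergence_le (hF : LipschitzWith C F) (z : EuclideanSpace ℝ (Fin n)) :
    divergence F z ≤ n * C := by
  calc divergence F z ≤ ∑ _i : Fin n, (C : ℝ) := Finset.sum_le_sum fun i _ ↦ by
        simpa using (le_abs_self _).trans (norm_lineDeriv_le_of_lipschitz ℝ
          (lipschitzWith_apply hF i) (x₀ := z) (v := EuclideanSpace.single i 1))
    _ = n * C := by simp

theorem divergence_ae_eq (hF : LipschitzWith C F) : divergence F =ᵐ[gauss n]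
    fun z ↦ ∑ i : Fin n, fderiv ℝ (fun w ↦ F w i) z (EuclideanSpace.single i 1) := by
  have differentiable : ∀ᵐ z ∂gauss n, ∀ i, DifferentiableAt ℝ (fun w ↦ F w i) z :=
    ae_all_iff.2 fun i ↦
      stdGaussian_absolutelyContinuous.ae_le (lipschitzWith_apply hF i).ae_differentiableAt
  filter_upwards [differentiable] with z hz
  exact Finset.sum_congr rfl fun i _ ↦ (hz i).lineDeriv_eq_fderiv

theorem integrable_fderiv_apply_single (hF : LipschitzWith C F) (i : Fin n) :
    Integrable (fun z ↦ fderiv ℝ (fun w ↦ F w i) z (EuclideanSpace.single i 1)) (gauss n) :=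
  (ExpLipschitz.of_lipschitzWith (lipschitzWith_apply hF i)).integrable_fderiv_apply
    (LipschitzWith.const (EuclideanSpace.single i 1))

theorem integrable_divergence (hF : LipschitzWith C F) : Integrable (divergence F) (gauss n) :=
  (integrable_finsetSum Finset.univ fun i _ ↦ integrable_fderiv_apply_single hF i).congr
    (divergence_ae_eq hF).symm

theorem integral_inner_eq_integral_divergence (hF : LipschitzWith C F) :
    ∫ z, ⟪z, F z⟫ ∂gauss n = ∫ z, divergence F z ∂gauss n := by
  have inner_single (i : Fin n) (z : EuclideanSpace ℝ (Fin n)) :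
      ⟪EuclideanSpace.single i (1 : ℝ), z⟫ = z i := by simp [EuclideanSpace.inner_single_left]
  have coordinate_expLipschitz (i : Fin n) : ExpLipschitz fun z ↦ F z i :=
    .of_lipschitzWith (lipschitzWith_apply hF i)
  have product_integrable (i : Fin n) :
      Integrable (fun z ↦ ⟪EuclideanSpace.single i (1 : ℝ), z⟫ * F z i) (gauss n) :=
    ((ExpLipschitz.of_lipschitzWith (innerSL ℝ (EuclideanSpace.single i (1 : ℝ))).lipschitz).mul
      (coordinate_expLipschitz i)).integrable
  calc ∫ z, ⟪z, F z⟫ ∂gauss n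
      = ∫ z, ∑ i, ⟪EuclideanSpace.single i (1 : ℝ), z⟫ * F z i ∂gauss n := by
        simp only [inner_single, PiLp.inner_apply, RCLike.inner_apply, conj_trivial, mul_comm]
    _ = ∑ i, ∫ z, fderiv ℝ (fun w ↦ F w i) z (EuclideanSpace.single i 1) ∂gauss n := by
        rw [integral_finsetSum _ fun i _ ↦ product_integrable i]
        exact Finset.sum_congr rfl fun i _ ↦
          integral_inner_mul_stdGaussian (coordinate_expLipschitz i) _
    _ = ∫ z, divergence F z ∂gauss n := by
        rw [← integral_finsetSum _ fun i _ ↦ integrable_fderiv_apply_single hF i]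
        exact integral_congr_ae (divergence_ae_eq hF).symm

theorem divergence_displacement_smul (K : Set (EuclideanSpace ℝ (Fin n)))
    (μ₀ h : EuclideanSpace ℝ (Fin n)) (σ : ℝ) :
    divergence (fun z ↦ displacement K μ₀ (σ • z)) h = σ * divLse K μ₀ σ h := by
  rw [divLse, divergence, divergence, Finset.mul_sum]
  refine Finset.sum_congr rfl fun i _ ↦ ?_
  have along_line (t : ℝ) :
      displacement K μ₀ (σ • (h + t • EuclideanSpace.single i 1)) i =
        proj K (obs μ₀ σ h + (σ * t) • EuclideanSpace.single i 1) i - μ₀ i := by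
    rw [displacement, obs, PiLp.sub_apply, smul_add, smul_smul, add_assoc]
  simp only [lineDeriv, along_line, deriv_sub_const_fun]
  rw [deriv_comp_mul_left σ fun t ↦ proj K (obs μ₀ σ h + t • EuclideanSpace.single i 1) i,
    mul_zero, smul_eq_mul]

variable (hc : IsClosed K) (hK : Convex ℝ K)
include hc hK

theorem divLse_le (hne : K.Nonempty) (μ₀ : EuclideanSpace ℝ (Fin n)) (σ : ℝ)
    (h : EuclideanSpace ℝ (Fin n)) : divLse K μ₀ σ h ≤ n := by
  simpa [divLse] using divergence_le (lipschitzWith_proj hc hK hne) (obs μ₀ σ h)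

theorem ae_differentiableAt_proj (hne : K.Nonempty) (μ₀ : EuclideanSpace ℝ (Fin n)) {σ : ℝ}
    (hσ : σ ≠ 0) : ∀ᵐ h ∂gauss n, DifferentiableAt ℝ (proj K) (obs μ₀ σ h) := by
  filter_upwards [ae_stdGaussian_smul_add hσ μ₀ (lipschitzWith_proj hc hK hne).ae_differentiableAt]
    with h hh
  rwa [obs, add_comm]

variable (hμ : μ₀ ∈ K)
include hμ

theorem lipschitzWith_displacement_smul (σ : ℝ) :
    LipschitzWith (1 * ‖σ‖₊) fun h ↦ displacement K μ₀ (σ • h) :=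
  (lipschitzWith_displacement hc hK hμ).comp (lipschitzWith_smul σ)

theorem integrable_divLse {σ : ℝ} (hσ : σ ≠ 0) : Integrable (divLse K μ₀ σ) (gauss n) := by
  have := (integrable_divergence (lipschitzWith_displacement_smul hc hK hμ σ)).const_mul σ⁻¹
  simpa only [divergence_displacement_smul, inv_mul_cancel_left₀ hσ] using this

theorem meanLrt_add_meanErr (σ : ℝ) :
    meanLrt K μ₀ σ + meanErr K μ₀ σ = 2 * σ ^ 2 * ∫ h, divLse K μ₀ σ h ∂gauss n := by
  have pointwise (h) : lrt K μ₀ σ h + err K μ₀ σ h = 2 * σ * ⟪h, displacement K μ₀ (σ • h)⟫ := by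
    rw [lrt_eq, err_eq, excess, real_inner_smul_left]
    ring
  calc meanLrt K μ₀ σ + meanErr K μ₀ σ
      = 2 * σ * ∫ h, ⟪h, displacement K μ₀ (σ • h)⟫ ∂gauss n := by
        rw [meanLrt, meanErr,
          ← integral_add (integrable_lrt hc hK hμ σ) (integrable_err hc hK hμ σ),
          ← integral_const_mul]
        simp only [pointwise]
    _ = 2 * σ * ∫ h, σ * divLse K μ₀ σ h ∂gauss n := by
        simp only [integral_inner_eq_integral_divergence
          (lipschitzWith_displacement_smul hc hK hμ σ), divergence_displacement_smul]
    _ = 2 * σ ^ 2 * ∫ h, divLse K μ₀ σ h ∂gauss n := by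
        rw [integral_const_mul]
        ring

theorem meanLrt_le (σ : ℝ) :
    meanLrt K μ₀ σ ≤ 2 * σ ^ 2 * ∫ h, divLse K μ₀ σ h ∂gauss n := by
  rw [← meanLrt_add_meanErr hc hK hμ σ]
  exact le_add_of_nonneg_right (meanErr_nonneg K μ₀ σ)

theorem integral_divLse_le {σ : ℝ} (hσ : σ ≠ 0) : ∫ h, divLse K μ₀ σ h ∂gauss n ≤ n := by
  simpa using integral_mono (integrable_divLse hc hK hμ hσ) (integrable_const (n : ℝ))
    (divLse_le hc hK ⟨μ₀, hμ⟩ μ₀ σ)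

end Divergence

section Pathwise

variable (hc : IsClosed K) (hK : Convex ℝ K) (hμ : μ₀ ∈ K) (h : EuclideanSpace ℝ (Fin n))
include hc hK hμ

theorem intervalIntegrable_err_div_sq (a b : ℝ) :
    IntervalIntegrable (fun τ : ℝ ↦ err K μ₀ τ h / τ ^ 2) volume a b := by
  refine (intervalIntegrable_const (c := ‖h‖ ^ 2)).mono_fun ?_ (.of_forall fun τ ↦ ?_)
  · have continuous_err : Continuous fun τ : ℝ ↦ err K μ₀ τ h := by
      simp only [err_eq]
      exact ((lipschitzWith_displacement hc hK hμ).continuous.comp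
        (continuous_id.smul continuous_const)).norm.pow 2
    exact (continuous_err.measurable.div (by fun_prop)).aestronglyMeasurable
  · beta_reduce
    rw [norm_div, Real.norm_of_nonneg (sq_nonneg ‖h‖), Real.norm_of_nonneg (sq_nonneg τ)]
    exact div_le_of_le_mul₀ (sq_nonneg τ) (sq_nonneg _)
      ((norm_err_le hc hK hμ τ h).trans_eq (mul_comm _ _))

theorem hasDerivAt_lrt (τ : ℝ) :
    HasDerivAt (fun τ ↦ lrt K μ₀ τ h) (2 * ⟪h, displacement K μ₀ (τ • h)⟫) τ := by
  have ray : HasDerivAt (fun τ : ℝ ↦ τ • h) h τ := by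
    simpa only [one_smul, id] using (hasDerivAt_id τ).smul_const h
  simp only [lrt_eq]
  refine ((hasGradientAt_excess hc hK hμ (τ • h)).hasFDerivAt.comp_hasDerivAt τ ray).congr_deriv ?_
  rw [InnerProductSpace.toDual_apply_apply, real_inner_smul_left, real_inner_comm]

theorem hasDerivAt_lrt_div {τ : ℝ} (hτ : τ ≠ 0) :
    HasDerivAt (fun τ ↦ lrt K μ₀ τ h / τ) (err K μ₀ τ h / τ ^ 2) τ := by
  refine ((hasDerivAt_lrt hc hK hμ h τ).div (hasDerivAt_id τ) hτ).congr_deriv ?_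
  rw [id, lrt_eq, err_eq, excess, real_inner_smul_left]
  ring

theorem continuous_lrt_div : Continuous fun τ ↦ lrt K μ₀ τ h / τ := by
  refine continuous_iff_continuousAt.2 fun τ ↦ ?_
  rcases eq_or_ne τ 0 with rfl | hτ
  · have bound (τ : ℝ) : ‖lrt K μ₀ τ h / τ‖ ≤ |τ| * ‖h‖ ^ 2 := by
      rw [norm_div, Real.norm_eq_abs τ]
      refine div_le_of_le_mul₀ (abs_nonneg τ) (by positivity)
        ((norm_lrt_le hc hK hμ τ h).trans_eq ?_)
      rw [← sq_abs τ]
      ring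
    rw [ContinuousAt, div_zero]
    exact squeeze_zero_norm bound (Continuous.tendsto' (by fun_prop) _ _ (by simp))
  · exact (hasDerivAt_lrt_div hc hK hμ h hτ).continuousAt

theorem lrt_eq_mul_integral {σ : ℝ} (hσ : 0 < σ) :
    lrt K μ₀ σ h = σ * ∫ τ in (0 : ℝ)..σ, err K μ₀ τ h / τ ^ 2 := by
  rw [intervalIntegral.integral_eq_sub_of_hasDerivAt_of_le hσ.le
    (continuous_lrt_div hc hK hμ h).continuousOn
    (fun τ hτ ↦ hasDerivAt_lrt_div hc hK hμ h hτ.1.ne')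
    (intervalIntegrable_err_div_sq hc hK hμ h 0 σ), div_zero, sub_zero, mul_div_cancel₀ _ hσ.ne']

theorem lrt_le_err_add_integral {σ : ℝ} (hσ : 0 < σ) :
    lrt K μ₀ σ h ≤ err K μ₀ σ h + 2 * σ *
      ∫ τ in (0 : ℝ)..σ, (err K μ₀ τ h / τ ^ 2 - err K μ₀ σ h / σ ^ 2) := by
  have integral_eq : σ * ∫ τ in (0 : ℝ)..σ, (err K μ₀ τ h / τ ^ 2 - err K μ₀ σ h / σ ^ 2) =
      lrt K μ₀ σ h - err K μ₀ σ h := by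
    rw [intervalIntegral.integral_sub (intervalIntegrable_err_div_sq hc hK hμ h 0 σ)
      intervalIntegrable_const, mul_sub, ← lrt_eq_mul_integral hc hK hμ h hσ,
      intervalIntegral.integral_const, sub_zero, smul_eq_mul]
    field_simp
  rw [mul_assoc, integral_eq]
  linarith [err_le_lrt hc hK hμ σ h]

end Pathwise

section Cone

theorem lrt_eq_err_add_inner_lse (K : Set (EuclideanSpace ℝ (Fin n)))
    (μ₀ h : EuclideanSpace ℝ (Fin n)) (σ : ℝ) :
    lrt K μ₀ σ h = err K μ₀ σ h +
      2 * ⟪lse K μ₀ σ h - μ₀ - σ • h, μ₀ - lse K μ₀ σ h⟫ := by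
  have displacement_eq : lse K μ₀ σ h - μ₀ = displacement K μ₀ (σ • h) := rfl
  rw [← neg_sub (lse K μ₀ σ h) μ₀, displacement_eq, lrt_eq, err_eq, excess, inner_neg_right,
    inner_sub_left, real_inner_self_eq_norm_sq]
  ring

theorem add_mem_of_smul_mem {V : Type*} [AddCommGroup V] [Module ℝ V] {K : Set V}
    (hK : Convex ℝ K) (hcone : ∀ c : ℝ, 0 < c → ∀ x ∈ K, c • x ∈ K) {x y : V} (hx : x ∈ K)
    (hy : y ∈ K) : x + y ∈ K := by
  have two_smul_midpoint := hcone 2 two_pos _ (hK.midpoint_mem hx hy)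
  rwa [midpoint_eq_smul_add, smul_smul, mul_invOf_self, one_smul] at two_smul_midpoint

theorem zero_mem_of_smul_mem {V : Type*} [AddCommGroup V] [Module ℝ V] [TopologicalSpace V]
    [ContinuousSMul ℝ V] {K : Set V} (hc : IsClosed K)
    (hcone : ∀ c : ℝ, 0 < c → ∀ x ∈ K, c • x ∈ K) {x : V} (hx : x ∈ K) : (0 : V) ∈ K := by
  have shrink : Tendsto (fun c : ℝ ↦ c • x) (𝓝[>] 0) (𝓝 0) :=
    (Continuous.tendsto' (by fun_prop) 0 0 (zero_smul ℝ x)).mono_left nhdsWithin_le_nhds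
  refine hc.mem_of_tendsto shrink ?_
  filter_upwards [self_mem_nhdsWithin] with c hc using hcone c hc x hx

theorem lse_mem (hc : IsClosed K) (hK : Convex ℝ K) (hne : K.Nonempty)
    (μ₀ : EuclideanSpace ℝ (Fin n)) (σ : ℝ) (h : EuclideanSpace ℝ (Fin n)) : lse K μ₀ σ h ∈ K :=
  (isLeastSquares_proj hc hK hne _).1

theorem lrt_le_err_add_inner (hc : IsClosed K) (hK : Convex ℝ K)
    (hcone : ∀ c : ℝ, 0 < c → ∀ x ∈ K, c • x ∈ K) (hne : K.Nonempty) {σ : ℝ}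
    {μ₀ h ν : EuclideanSpace ℝ (Fin n)} (hν : lse K μ₀ σ h - ν ∈ K) :
    lrt K μ₀ σ h ≤ err K μ₀ σ h + 2 * ⟪lse K μ₀ σ h - μ₀ - σ • h, μ₀ - ν⟫ := by
  have variational : ⟪obs μ₀ σ h - lse K μ₀ σ h, lse K μ₀ σ h - ν⟫ ≤ 0 := by
    have := (isLeastSquares_proj hc hK hne (obs μ₀ σ h)).inner_le_zero hK
      (add_mem_of_smul_mem hK hcone (lse_mem hc hK hne μ₀ σ h) hν)
    rwa [← lse, add_sub_cancel_left] at this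
  have residual : lse K μ₀ σ h - μ₀ - σ • h = -(obs μ₀ σ h - lse K μ₀ σ h) := by
    rw [obs]; abel
  have split : μ₀ - ν = (μ₀ - lse K μ₀ σ h) + (lse K μ₀ σ h - ν) := by abel
  rw [lrt_eq_err_add_inner_lse, split, inner_add_right, residual, inner_neg_left, inner_neg_left]
  linarith

end Cone

end SeqModel

theorem proposition4p6 :
    (∀ (n : ℕ) (K : Set (EuclideanSpace ℝ (Fin n))) (μ₀ : EuclideanSpace ℝ (Fin n)) (σ : ℝ),
      IsClosed K → Convex ℝ K → μ₀ ∈ K → 0 < σ →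
      -- the expectations that occur below exist, and so does the divergence almost surely
      (Integrable (SeqModel.err K μ₀ σ) (SeqModel.gauss n) ∧
        Integrable (SeqModel.lrt K μ₀ σ) (SeqModel.gauss n) ∧
        Integrable (SeqModel.divLse K μ₀ σ) (SeqModel.gauss n) ∧
        ∀ᵐ h ∂SeqModel.gauss n,
          DifferentiableAt ℝ (SeqModel.proj K) (SeqModel.obs μ₀ σ h)) ∧
      -- (1) bounds on the mean
      (SeqModel.meanLrt K μ₀ σ ≤ 2 * σ ^ 2 * ∫ h, SeqModel.divLse K μ₀ σ h ∂SeqModel.gauss n) ∧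
      (2 * σ ^ 2 * ∫ h, SeqModel.divLse K μ₀ σ h ∂SeqModel.gauss n ≤ 2 * σ ^ 2 * n) ∧
      -- (2) pathwise comparison with the squared error
      (∀ h : EuclideanSpace ℝ (Fin n),
        SeqModel.err K μ₀ σ h ≤ SeqModel.lrt K μ₀ σ h ∧
        IntervalIntegrable
          (fun τ : ℝ => SeqModel.err K μ₀ τ h / τ ^ 2 - SeqModel.err K μ₀ σ h / σ ^ 2)
          volume 0 σ ∧
        SeqModel.lrt K μ₀ σ h ≤ SeqModel.err K μ₀ σ h + 2 * σ *
          ∫ τ in (0 : ℝ)..σ,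
            (SeqModel.err K μ₀ τ h / τ ^ 2 - SeqModel.err K μ₀ σ h / σ ^ 2)) ∧
      -- (2) for cones; `ν` is chosen after `h`, so it may be random
      ((∀ c : ℝ, 0 < c → ∀ x ∈ K, c • x ∈ K) →
        ∀ h : EuclideanSpace ℝ (Fin n),
          (∀ ν : EuclideanSpace ℝ (Fin n),
            (∀ x ∈ K, x + ν ∈ K) → SeqModel.lse K μ₀ σ h - ν ∈ K →
            SeqModel.err K μ₀ σ h ≤ SeqModel.lrt K μ₀ σ h ∧
            SeqModel.lrt K μ₀ σ h ≤ SeqModel.err K μ₀ σ h +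
              2 * inner ℝ (SeqModel.lse K μ₀ σ h - μ₀ - σ • h) (μ₀ - ν)) ∧
          -- `ν = μ̂_K(σ)` is admissible and gives equality
          (∀ x ∈ K, x + SeqModel.lse K μ₀ σ h ∈ K) ∧
          SeqModel.lse K μ₀ σ h - SeqModel.lse K μ₀ σ h ∈ K ∧
          SeqModel.lrt K μ₀ σ h = SeqModel.err K μ₀ σ h +
            2 * inner ℝ (SeqModel.lse K μ₀ σ h - μ₀ - σ • h) (μ₀ - SeqModel.lse K μ₀ σ h)) ∧
      -- (3) variance bound
      (MemLp (SeqModel.lrt K μ₀ σ) 2 (SeqModel.gauss n) ∧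
        variance (SeqModel.lrt K μ₀ σ) (SeqModel.gauss n) ≤
          4 * σ ^ 2 * SeqModel.meanErr K μ₀ σ) ∧
      -- (4) exponential moment bound
      (∀ l : ℝ, l ^ 2 < SeqModel.meanErr K μ₀ σ / (8 * σ ^ 2) →
        Integrable (fun h => Real.exp (l * ((SeqModel.lrt K μ₀ σ h - SeqModel.meanLrt K μ₀ σ) /
          (σ * √(SeqModel.meanErr K μ₀ σ))))) (SeqModel.gauss n) ∧
        ∫ h, Real.exp (l * ((SeqModel.lrt K μ₀ σ h - SeqModel.meanLrt K μ₀ σ) /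
            (σ * √(SeqModel.meanErr K μ₀ σ)))) ∂SeqModel.gauss n ≤
          Real.exp (4 * l ^ 2 / (1 - 8 * (σ ^ 2 / SeqModel.meanErr K μ₀ σ) * l ^ 2)))) ∧
    -- (4) tail bound, with an absolute constant
    (∃ L : ℝ, 0 < L ∧
      ∀ (n : ℕ) (K : Set (EuclideanSpace ℝ (Fin n))) (μ₀ : EuclideanSpace ℝ (Fin n)) (σ : ℝ),
        IsClosed K → Convex ℝ K → μ₀ ∈ K → 0 < σ → ∀ t : ℝ, 0 ≤ t →
        (SeqModel.gauss n).real
            {h | √(σ ^ 2 * SeqModel.meanErr K μ₀ σ * t) + σ ^ 2 * t ≤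
              L⁻¹ * |SeqModel.lrt K μ₀ σ h - SeqModel.meanLrt K μ₀ σ|} ≤
          L * Real.exp (-t / L)) := by
  refine ⟨fun n K μ₀ σ hc hK hμ hσ ↦ ⟨⟨SeqModel.integrable_err hc hK hμ σ,
    SeqModel.integrable_lrt hc hK hμ σ, SeqModel.integrable_divLse hc hK hμ hσ.ne',
    SeqModel.ae_differentiableAt_proj hc hK ⟨μ₀, hμ⟩ μ₀ hσ.ne'⟩,
    SeqModel.meanLrt_le hc hK hμ σ, ?mean_div, ?pathwise, ?cone,
    ⟨SeqModel.memLp_lrt hc hK hμ hσ.ne', SeqModel.variance_lrt_le hc hK hμ hσ.ne'⟩,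
    fun l hl ↦ SeqModel.integral_exp_standardized_lrt_le hc hK hμ hσ hl⟩,
    3, by norm_num, fun n K μ₀ σ hc hK hμ hσ t ht ↦
      SeqModel.measureReal_abs_lrt_sub_ge_le hc hK hμ hσ.ne' ht⟩
  case mean_div =>
    exact mul_le_mul_of_nonneg_left (SeqModel.integral_divLse_le hc hK hμ hσ.ne') (by positivity)
  case pathwise =>
    exact fun h ↦ ⟨SeqModel.err_le_lrt hc hK hμ σ h,
      (SeqModel.intervalIntegrable_err_div_sq hc hK hμ h 0 σ).sub intervalIntegrable_const,
      SeqModel.lrt_le_err_add_integral hc hK hμ h hσ⟩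
  case cone =>
    refine fun hcone h ↦ ⟨fun ν _ hν ↦ ⟨SeqModel.err_le_lrt hc hK hμ σ h,
        SeqModel.lrt_le_err_add_inner hc hK hcone ⟨μ₀, hμ⟩ hν⟩,
      fun x hx ↦ SeqModel.add_mem_of_smul_mem hK hcone hx
        (SeqModel.lse_mem hc hK ⟨μ₀, hμ⟩ μ₀ σ h), ?_,
      SeqModel.lrt_eq_err_add_inner_lse K μ₀ h σ⟩
    rw [sub_self]
    exact SeqModel.zero_mem_of_smul_mem hc hcone hμ
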